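/- Let $r,k,n$ be integers with $k\ge 5$, $n\ge k$, $3\le r\le \lfloor (k-1)/2\rfloor+1$ and $n\ge k^2/2$, and put $t=\lfloor (k-1)/2\rfloor$. Let $\mathcal H=\{K_r\}\cup\mathcal C_{\ge k}$, where $K_r$ is the complete graph on $r$ vertices and $\mathcal C_{\ge k}$ is the set of all cycles of length at least $k$; a graph is $\mathcal H$-free if it contains no member of $\mathcal H$ as a (not necessarily induced) subgraph. Let $\mathrm{ex}_{2\text{-conn}}(n,\mathcal H)$ be the maximum number of edges in a $2$-connected $\mathcal H$-free graph on $n$ vertices, and let $\mathrm{ex}(m,K_s)$ be the maximum number of edges in a $K_s$-free graph on $m$ vertices. Let $G_2=T(t,r-2)\vee I_{n-t}$ be the join of the Turán graph $T(t,r-2)$ (the balanced complete $(r-2)$-partite graph on $t$ vertices) with an independent set $I_{n-t}$ of $n-t$ vertices. Then $$\mathrm{ex}_{2\text{-conn}}(n,\mathcal H)=e(G_2)=\mathrm{ex}(t,K_{r-1})+t(n-t),$$ where $e(G_2)$ is the number of edges of $G_2$. -/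

import Mathlib

/-- A finite graph is 2-connected if it has at least three vertices, is connected, and stays
connected after the deletion of any single vertex. -/
def IsTwoConnected {V : Type*} (G : SimpleGraph V) : Prop :=
  3 ≤ Nat.card V ∧ G.Connected ∧ ∀ v : V, (G.induce ({v}ᶜ : Set V)).Connected

/-- A family of finite graphs (each with vertex set `Fin m` for some `m`). -/
abbrev GraphFamily : Type := Set (Σ m : ℕ, SimpleGraph (Fin m))

/-- `G` is `F`-free if no member of `F` is contained in `G` as a (not necessarily induced)
subgraph. -/
def FamilyFree (F : GraphFamily) {V : Type*} (G : SimpleGraph V) : Prop :=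
  ∀ H ∈ F, H.2.Free G

/-- The family `𝒞_{≥ k}` of all cycles of length at least `k` (used for `k ≥ 3`). -/
def longCycles (k : ℕ) : GraphFamily :=
  {H | ∃ m : ℕ, k ≤ m ∧ H = ⟨m, SimpleGraph.cycleGraph m⟩}

/-- The family `{K_r, 𝒞_{≥ k}}`. -/
def cliqueAndLongCycles (r k : ℕ) : GraphFamily :=
  insert ⟨r, (⊤ : SimpleGraph (Fin r))⟩ (longCycles k)

/-- The set of the numbers of edges of the 2-connected `F`-free graphs on `n` vertices; its
greatest element is `ex_{2-conn}(n, F)`. -/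
def twoConnEdgeCounts (n : ℕ) (F : GraphFamily) : Set ℕ :=
  {e | ∃ G : SimpleGraph (Fin n), IsTwoConnected G ∧ FamilyFree F G ∧ G.edgeSet.ncard = e}

/-- The join `G ∨ H`: the disjoint union of `G` and `H` together with all edges between them. -/
def graphJoin {V W : Type*} (G : SimpleGraph V) (H : SimpleGraph W) : SimpleGraph (V ⊕ W) :=
  (G ⊕g H) ⊔ completeBipartiteGraph V W

/-- The graph `G₂ = T(t, r - 2) ∨ I_{n - t}` with `t = ⌊(k - 1) / 2⌋`. -/
def graphG2 (n k r : ℕ) : SimpleGraph (Fin ((k - 1) / 2) ⊕ Fin (n - (k - 1) / 2)) :=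
  graphJoin (SimpleGraph.turanGraph ((k - 1) / 2) (r - 2))
    (⊥ : SimpleGraph (Fin (n - (k - 1) / 2)))

/-!
Let `C` be a longest cycle of a 2-connected graph without a `K_r` and without cycles of length at
least `k`, so that `C` has at most `2 * t + 1` vertices. Any nonempty set of vertices outside `C`,
each with a neighbour outside `C`, has a nonempty subset accounting for fewer than `t` edges per
vertex: a single vertex of small degree, or the vertices outside `C` of a longest path into `C`.
The remaining vertices outside `C` are only adjacent to `C`, and to at most `t` of its vertices, as
no two neighbours are consecutive on `C`. If one of them is adjacent to a set `A` of exactly `t`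
vertices of `C`, then the successors of `A` on `C` are independent, so the vertices of `C` outside
`A` span at most one edge, while `A` is `K_{r-1}`-free. Such an extra edge is paid for by a missing
edge to `A`, unless `A` is even `K_{r-2}`-free. If all of them have fewer than `t` neighbours, then
`k ^ 2 / 2 ≤ n` makes up for a complete graph on `C`.
-/

section Walks

open SimpleGraph

variable {V : Type*} {G : SimpleGraph V} {u v w x y : V}

theorem isPath_append {p : G.Walk u v} {q : G.Walk v w} (hp : p.IsPath) (hq : q.IsPath)
    (h : ∀ z ∈ p.support, z ∈ q.support → z = v) : (p.append q).IsPath := by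
  rw [Walk.isPath_def, Walk.support_append, List.nodup_append']
  refine ⟨hp.support_nodup, hq.support_nodup.tail, fun z hzp hzq ↦ ?_⟩
  have hnodup : (v :: q.support.tail).Nodup := q.cons_tail_support ▸ hq.support_nodup
  exact (List.nodup_cons.1 hnodup).1 (h z hzp (List.mem_of_mem_tail hzq) ▸ hzq)

theorem eq_of_mem_support_of_isPath_append {p : G.Walk u v} {q : G.Walk v w}
    (h : (p.append q).IsPath) {z : V} (hp : z ∈ p.support) (hq : z ∈ q.support) : z = v := by
  by_contra hz
  exact h.ne_of_mem_support_of_append hz hp hq rfl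

theorem isCycle_append_comm {p : G.Walk u v} {q : G.Walk v u} (h : (p.append q).IsCycle) :
    (q.append p).IsCycle := by
  rw [Walk.isCycle_def, Walk.isTrail_append] at h ⊢
  obtain ⟨⟨hp, hq, hd⟩, hne, hnodup⟩ := h
  refine ⟨⟨hq, hp, hd.symm⟩, fun hnil ↦ hne ?_, ?_⟩
  · rw [Walk.eq_nil_iff_nil, Walk.nil_append_iff] at hnil ⊢
    exact hnil.symm
  · rw [Walk.tail_support_append] at hnodup ⊢
    exact (List.perm_append_comm.nodup_iff).1 hnodup

theorem exists_append_first_mem {B : Set V} (p : G.Walk u v) (hp : ∃ z ∈ p.support, z ∈ B) :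
    ∃ y ∈ B, ∃ (q : G.Walk u y) (r : G.Walk y v), p = q.append r ∧
      ∀ z ∈ q.support, z ∈ B → z = y := by
  induction p with
  | @nil u =>
    refine ⟨u, by simpa using hp, .nil, .nil, rfl, by simp⟩
  | @cons u v w h p ih =>
    by_cases hu : u ∈ B
    · exact ⟨u, hu, .nil, p.cons h, rfl, by simp⟩
    · obtain ⟨y, hy, q, r, rfl, hq⟩ := ih (by simpa [hu] using hp)
      refine ⟨y, hy, q.cons h, r, rfl, fun z hz hzB ↦ ?_⟩
      rcases List.mem_cons.1 hz with rfl | hz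
      · exact absurd hzB hu
      · exact hq z hz hzB

theorem exists_append_last_mem {B : Set V} (p : G.Walk u v) (hp : ∃ z ∈ p.support, z ∈ B) :
    ∃ y ∈ B, ∃ (q : G.Walk u y) (r : G.Walk y v), p = q.append r ∧
      ∀ z ∈ r.support, z ∈ B → z = y := by
  obtain ⟨y, hy, q, r, hqr, hq⟩ := exists_append_first_mem p.reverse (by simpa using hp)
  refine ⟨y, hy, r.reverse, q.reverse, ?_, by simpa using hq⟩
  rw [← Walk.reverse_append, ← hqr, Walk.reverse_reverse]

theorem exists_isPath_between {A B : Set V} (p : G.Walk u v) (hu : u ∈ A) (hv : v ∈ B) :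
    ∃ x ∈ A, ∃ y ∈ B, ∃ q : G.Walk x y, q.IsPath ∧ q.support ⊆ p.support ∧
      (∀ z ∈ q.support, z ∈ A → z = x) ∧ ∀ z ∈ q.support, z ∈ B → z = y := by
  classical
  obtain ⟨y, hy, q, r, rfl, hq⟩ := exists_append_first_mem p ⟨v, p.end_mem_support, hv⟩
  obtain ⟨x, hx, q', s, rfl, hs⟩ := exists_append_last_mem q ⟨u, q.start_mem_support, hu⟩
  have hsub : s.bypass.support ⊆ s.support := s.support_bypass_subset_support
  refine ⟨x, hx, y, hy, s.bypass, s.bypass_isPath, fun z hz ↦ ?_, fun z hz ↦ hs z (hsub hz),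
    fun z hz ↦ hq z ?_⟩ <;>
  simp [Walk.mem_support_append_iff, hsub hz]

theorem exists_append_of_le_length (p : G.Walk u v) {i : ℕ} (hi : i ≤ p.length) :
    ∃ (q : G.Walk u (p.getVert i)) (r : G.Walk (p.getVert i) v), p = q.append r ∧ q.length = i := by
  induction p generalizing i with
  | nil => exact ⟨.nil, .nil, rfl, by simpa [eq_comm] using hi⟩
  | cons h p ih =>
    cases i with
    | zero => exact ⟨.nil, p.cons h, rfl, rfl⟩
    | succ i =>
      obtain ⟨q, r, hqr, hq⟩ := ih (Nat.le_of_succ_le_succ hi)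
      exact ⟨q.cons h, r, congrArg (Walk.cons h) hqr, by simp [hq]⟩

/-- `v` can be reached from `u` by a walk all of whose vertices belong to `X`. -/
def ReachableIn (G : SimpleGraph V) (X : Set V) (u v : V) : Prop :=
  ∃ p : G.Walk u v, ∀ z ∈ p.support, z ∈ X

namespace ReachableIn

variable {X Y : Set V}

theorem refl (h : u ∈ X) : ReachableIn G X u u :=
  ⟨.nil, by simpa using h⟩

theorem mono (h : ReachableIn G X u v) (hXY : X ⊆ Y) : ReachableIn G Y u v :=
  h.imp fun _ hp z hz ↦ hXY (hp z hz)

theorem symm (h : ReachableIn G X u v) : ReachableIn G X v u :=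
  let ⟨p, hp⟩ := h
  ⟨p.reverse, by simpa using hp⟩

theorem trans (h : ReachableIn G X u v) (h' : ReachableIn G X v w) : ReachableIn G X u w :=
  let ⟨p, hp⟩ := h
  let ⟨q, hq⟩ := h'
  ⟨p.append q, fun z hz ↦ ((Walk.mem_support_append_iff p q).1 hz).elim (hp z) (hq z)⟩

theorem right_mem (h : ReachableIn G X u v) : v ∈ X :=
  let ⟨p, hp⟩ := h
  hp v p.end_mem_support

theorem left_mem (h : ReachableIn G X u v) : u ∈ X :=
  h.symm.right_mem

end ReachableIn

theorem reachableIn_of_adj {X : Set V} (h : G.Adj u v) (hu : u ∈ X) (hv : v ∈ X) :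
    ReachableIn G X u v :=
  ⟨h.toWalk, by simp [hu, hv]⟩

theorem reachableIn_of_mem_support {X : Set V} {p : G.Walk u v} (hp : ∀ z ∈ p.support, z ∈ X)
    (hw : w ∈ p.support) : ReachableIn G X u w := by
  classical
  exact ⟨p.takeUntil w hw, fun z hz ↦ hp z (p.support_takeUntil_subset_support hw hz)⟩

theorem ReachableIn.reachableIn_setOf {X : Set V} (h : ReachableIn G X u v) :
    ReachableIn G {z | ReachableIn G X u z} u v :=
  let ⟨p, hp⟩ := h
  ⟨p, fun _ hz ↦ reachableIn_of_mem_support hp hz⟩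

theorem ReachableIn.exists_adj_mem {X Y : Set V} (h : ReachableIn G X u v) (hu : u ∉ Y)
    (hv : v ∈ Y) : ∃ x, ∃ y ∈ Y, ReachableIn G (X \ Y) u x ∧ G.Adj x y := by
  obtain ⟨p, hp⟩ := h
  induction p with
  | nil => exact absurd hv hu
  | @cons u u' _ huu' p ih =>
    have huX : u ∈ X \ Y := ⟨hp u (Walk.start_mem_support _), hu⟩
    by_cases hu' : u' ∈ Y
    · exact ⟨u, u', hu', .refl huX, huu'⟩
    · obtain ⟨x, y, hy, hux, hxy⟩ := ih hu' hv fun z hz ↦ hp z (List.mem_cons_of_mem _ hz)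
      exact ⟨x, y, hy, (reachableIn_of_adj huu' huX hux.left_mem).trans hux, hxy⟩

theorem IsTwoConnected.finite (h : IsTwoConnected G) : Finite V :=
  Nat.finite_of_card_ne_zero (by have := h.1; omega)

theorem IsTwoConnected.reachableIn_compl (h : IsTwoConnected G) (hu : u ≠ v) (hw : w ≠ v) :
    ReachableIn G {v}ᶜ u w := by
  obtain ⟨p⟩ := (h.2.2 v).preconnected ⟨u, hu⟩ ⟨w, hw⟩
  refine ⟨p.map (Embedding.induce _).toHom, fun z hz ↦ ?_⟩
  obtain ⟨z', -, rfl⟩ := List.mem_map.1 (Walk.support_map _ p ▸ hz)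
  exact z'.2

end Walks

section Linkage

open SimpleGraph

variable {V : Type*} {G : SimpleGraph V} {r r' : V} {C T X Z : Set V}

/-- A set `X ∋ r` that separates two disjoint routes to `C`: from `r` one inside `X`, from `T` one
outside `X`. -/
structure IsLinkage (G : SimpleGraph V) (T C : Set V) (r : V) (X : Set V) : Prop where
  root_mem : r ∈ X
  reachable : ∀ x ∈ X, ReachableIn G X r x
  disjoint : Disjoint X T
  inter_nonempty : (X ∩ C).Nonempty
  exists_outside : ∃ a ∈ T, ∃ b ∈ C, ReachableIn G Xᶜ a b

theorem ReachableIn.compl_insert_or_exists_isPath {a b : V} (h : ReachableIn G Xᶜ a b) (r : V) :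
    ReachableIn G (insert r X)ᶜ a b ∨ ∃ p : G.Walk r b, p.IsPath ∧ ∀ z ∈ p.support, z ∉ X := by
  classical
  obtain ⟨p, hp⟩ := h
  by_cases hrp : r ∈ p.support
  · refine .inr ⟨(p.dropUntil r hrp).bypass, Walk.bypass_isPath _, fun z hz ↦ hp z ?_⟩
    exact p.support_dropUntil_subset_support hrp (Walk.support_bypass_subset_support _ hz)
  · refine .inl ⟨p, fun z hz ↦ ?_⟩
    rintro (rfl | hzX)
    exacts [hrp hz, hp z hz hzX]

namespace IsLinkage

theorem of_mem (h : IsLinkage G T C r X) (hr' : r' ∈ X) : IsLinkage G T C r' X :=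
  { h with
    root_mem := hr'
    reachable := fun x hx ↦ (h.reachable r' hr').symm.trans (h.reachable x hx) }

theorem insert_root (h : IsLinkage G T C r X) (hr : G.Adj r r') (hr' : r' ∉ T)
    (hout : ∃ a ∈ T, ∃ b ∈ C, ReachableIn G (insert r' X)ᶜ a b) :
    IsLinkage G T C r' (insert r' X) where
  root_mem := Set.mem_insert r' X
  reachable := by
    rintro x (rfl | hx)
    · exact .refl (Set.mem_insert x X)
    · exact (reachableIn_of_adj hr.symm (Set.mem_insert r' X) (.inr h.root_mem)).trans
        ((h.reachable x hx).mono (Set.subset_insert r' X))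
  disjoint := Set.disjoint_insert_left.2 ⟨hr', h.disjoint⟩
  inter_nonempty := h.inter_nonempty.mono (Set.inter_subset_inter_left C (Set.subset_insert r' X))
  exists_outside := hout

theorem exists_reachableIn_union (h2 : IsTwoConnected G) (h : IsLinkage G T C r X)
    (hr'X : r' ∉ X) {a : V} (ha : a ∉ insert r' X)
    (hZ : ∀ z, ReachableIn G (insert r' X)ᶜ a z → z ∈ Z) :
    ∃ b ∈ C, ReachableIn G (X ∪ Z) a b := by
  have har' : a ≠ r' := fun har' ↦ ha (.inl har')
  have hrr' : r ≠ r' := fun hrr' ↦ hr'X (hrr' ▸ h.root_mem)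
  obtain ⟨z, x, hx, haz, hzx⟩ := (h2.reachableIn_compl har' hrr').exists_adj_mem
    (fun haX ↦ ha (.inr haX)) h.root_mem
  have haz' : ReachableIn G (insert r' X)ᶜ a z := haz.mono fun w hw hw' ↦ hw'.elim hw.1 hw.2
  have hazZ : ReachableIn G (X ∪ Z) a z :=
    haz'.reachableIn_setOf.mono fun w hw ↦ .inr (hZ w hw)
  obtain ⟨b, hbX, hbC⟩ := h.inter_nonempty
  have hxb : ReachableIn G X x b := (h.reachable x hx).symm.trans (h.reachable b hbX)
  exact ⟨b, hbC, (hazZ.trans (reachableIn_of_adj hzx hazZ.right_mem (.inl hx))).trans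
    (hxb.mono Set.subset_union_left)⟩

/-- The part of the old outside route after its last visit to `r'` becomes the new inside route. -/
theorem exists_of_separated (h2 : IsTwoConnected G) (h : IsLinkage G T C r X) (hr'T : r' ∉ T)
    (hr'X : r' ∉ X) (hsep : ¬ ∃ a ∈ T, ∃ b ∈ C, ReachableIn G (insert r' X)ᶜ a b) :
    ∃ X', IsLinkage G T C r' X' := by
  let Z : Set V := {z | ∃ a ∈ T, ReachableIn G (insert r' X)ᶜ a z}
  have hTY : ∀ a ∈ T, a ∉ insert r' X := by
    rintro a ha (rfl | haX)
    exacts [hr'T ha, Set.disjoint_left.1 h.disjoint haX ha]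
  have hZY : ∀ z ∈ Z, z ∉ insert r' X := fun z ⟨_, _, haz⟩ ↦ haz.right_mem
  have hX' : ∀ z, ReachableIn G (X ∪ Z)ᶜ r' z → z ∉ X ∪ Z := fun _ hz ↦ hz.right_mem
  obtain ⟨a, haT, b, hbC, hab⟩ := h.exists_outside
  obtain ⟨p, hp, hpX⟩ := (hab.compl_insert_or_exists_isPath r').resolve_left
    fun hab' ↦ hsep ⟨a, haT, b, hbC, hab'⟩
  have hpZ : ∀ z ∈ p.support, z ∉ Z := by
    rintro z hz hzZ
    obtain ⟨q, s, rfl⟩ := Walk.mem_support_iff_exists_append.1 hz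
    obtain ⟨a', ha'T, ha'z⟩ := hzZ
    refine hsep ⟨a', ha'T, b, hbC, ha'z.trans ⟨s, fun w hw ↦ ?_⟩⟩
    rintro (rfl | hwX)
    · exact ha'z.right_mem
        (.inl (eq_of_mem_support_of_isPath_append hp q.start_mem_support hw).symm)
    · exact hpX w ((Walk.mem_support_append_iff q s).2 (.inr hw)) hwX
  have hr' : r' ∉ X ∪ Z := fun hr' ↦
    hr'.elim hr'X fun hr'Z ↦ hZY r' hr'Z (Set.mem_insert r' X)
  obtain ⟨c, hcC, hac⟩ := h.exists_reachableIn_union h2 hr'X (hTY a haT)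
    (Z := Z) fun z hz ↦ ⟨a, haT, hz⟩
  refine ⟨{z | ReachableIn G (X ∪ Z)ᶜ r' z}, ⟨.refl hr', fun x hx ↦ hx.reachableIn_setOf,
    Set.disjoint_left.2 fun z hz hzT ↦ hX' z hz (.inr ⟨z, hzT, .refl (hTY z hzT)⟩),
    ⟨b, ⟨p, fun z hz ↦ ?_⟩, hbC⟩, a, haT, c, hcC, hac.mono fun z hz hz' ↦ hX' z hz' hz⟩⟩
  exact fun hz' ↦ hz'.elim (hpX z hz) (hpZ z hz)

theorem exists_of_adj (h2 : IsTwoConnected G) (h : IsLinkage G T C r X) (hr : G.Adj r r')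
    (hr' : r' ∉ T) : ∃ X', IsLinkage G T C r' X' := by
  by_cases hr'X : r' ∈ X
  · exact ⟨X, h.of_mem hr'X⟩
  by_cases hout : ∃ a ∈ T, ∃ b ∈ C, ReachableIn G (insert r' X)ᶜ a b
  · exact ⟨_, h.insert_root hr hr' hout⟩
  · exact h.exists_of_separated h2 hr' hr'X hout

end IsLinkage

theorem IsTwoConnected.exists_isLinkage (h2 : IsTwoConnected G) (hC : C.Nontrivial)
    (hT : T.Nonempty) {y : V} (hy : y ∈ C) (h : ReachableIn G Tᶜ r y) :
    ∃ X, IsLinkage G T C r X := by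
  obtain ⟨p, hp⟩ := h
  induction p with
  | @nil r =>
    have hrT : r ∉ T := hp r (by simp)
    obtain ⟨a, ha⟩ := hT
    obtain ⟨c, hc, hcr⟩ := hC.exists_ne r
    refine ⟨{r}, rfl, ?_, Set.disjoint_singleton_left.2 hrT, ⟨r, rfl, hy⟩, a, ha, c, hc,
      h2.reachableIn_compl (fun har ↦ hrT (har ▸ ha)) hcr⟩
    rintro x rfl
    exact .refl rfl
  | @cons r s _ hrs p ih =>
    obtain ⟨X, hX⟩ := ih hy fun z hz ↦ hp z (List.mem_cons_of_mem _ hz)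
    exact hX.exists_of_adj h2 hrs.symm (hp r (Walk.start_mem_support _))

theorem IsTwoConnected.exists_disjoint_isPath (h2 : IsTwoConnected G) (hC : C.Nontrivial)
    (hT : T.Nonempty) {y : V} (hy : y ∈ C) (h : ReachableIn G Tᶜ r y) :
    ∃ w ∈ T, ∃ x₁ ∈ C, ∃ x₂ ∈ C, ∃ (p : G.Walk w x₁) (q : G.Walk r x₂), p.IsPath ∧ q.IsPath ∧
      p.support.Disjoint q.support ∧ (∀ z ∈ p.support, z ∈ T → z = w) ∧ (∀ z ∈ q.support, z ∉ T) ∧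
      (∀ z ∈ p.support, z ∈ C → z = x₁) ∧ ∀ z ∈ q.support, z ∈ C → z = x₂ := by
  obtain ⟨X, hX⟩ := h2.exists_isLinkage hC hT hy h
  obtain ⟨a, ha, b, hb, p, hp⟩ := hX.exists_outside
  obtain ⟨c, hcX, hcC⟩ := hX.inter_nonempty
  obtain ⟨q, hq⟩ := hX.reachable c hcX
  obtain ⟨w, hw, x₁, hx₁, p', hp', hpp', hpT, hpC⟩ := exists_isPath_between p ha hb
  obtain ⟨_, rfl, x₂, hx₂, q', hq', hqq', -, hqC⟩ :=
    exists_isPath_between q (Set.mem_singleton r) hcC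
  exact ⟨w, hw, x₁, hx₁, x₂, hx₂, p', q', hp', hq',
    fun z hzp hzq ↦ hp z (hpp' hzp) (hq z (hqq' hzq)), hpT,
    fun z hz ↦ Set.disjoint_left.1 hX.disjoint (hq z (hqq' hz)), hpC, hqC⟩

end Linkage

section Ears

open SimpleGraph

variable {V : Type*} {G : SimpleGraph V} {u v w x y : V} {C : Set V}

/-- An ear of the vertex set `C`: a path between two distinct vertices of `C` with no inner vertex
in `C`. -/
structure IsEar (C : Set V) (p : G.Walk x y) : Prop where
  isPath : p.IsPath
  left_mem : x ∈ C
  right_mem : y ∈ C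
  ne : x ≠ y
  eq_or_eq : ∀ z ∈ p.support, z ∈ C → z = x ∨ z = y

theorem IsEar.reverse {p : G.Walk x y} (h : IsEar C p) : IsEar C p.reverse where
  isPath := h.isPath.reverse
  left_mem := h.right_mem
  right_mem := h.left_mem
  ne := h.ne.symm
  eq_or_eq z hz hzC := (h.eq_or_eq z (by simpa using hz) hzC).symm

/-- A path that leaves the complement of `C` only at its last vertex. -/
structure IsAccessPath (C : Set V) (p : G.Walk v y) : Prop where
  isPath : p.IsPath
  mem_iff : ∀ z ∈ p.support, z ∈ C ↔ z = y

namespace IsAccessPath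

variable {p : G.Walk v y}

theorem end_mem (h : IsAccessPath C p) : y ∈ C :=
  (h.mem_iff y p.end_mem_support).2 rfl

theorem cons (h : IsAccessPath C p) (hu : u ∉ p.support) (huC : u ∉ C) (huv : G.Adj u v) :
    IsAccessPath C (p.cons huv) where
  isPath := h.isPath.cons hu
  mem_iff z hz := by
    rcases List.mem_cons.1 hz with rfl | hz
    · exact iff_of_false huC fun hzy ↦ huC (hzy ▸ h.end_mem)
    · exact h.mem_iff z hz

theorem isEar_cons (h : IsAccessPath C p) (hx : x ∈ C) (hxy : x ≠ y) (hxv : G.Adj x v) :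
    IsEar C (p.cons hxv) where
  isPath := h.isPath.cons fun hxp ↦ hxy ((h.mem_iff x hxp).1 hx)
  left_mem := hx
  right_mem := h.end_mem
  ne := hxy
  eq_or_eq z hz hzC := by
    rcases List.mem_cons.1 hz with rfl | hz
    · exact .inl rfl
    · exact .inr ((h.mem_iff z hz).1 hzC)

theorem of_adj (hv : v ∉ C) (hy : y ∈ C) (hvy : G.Adj v y) : IsAccessPath C hvy.toWalk where
  isPath := .of_adj hvy
  mem_iff z hz := by
    rcases (by simpa using hz : z = v ∨ z = y) with rfl | rfl
    · exact iff_of_false hv hvy.ne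
    · exact iff_of_true hy rfl

end IsAccessPath

theorem exists_isAccessPath_of_reachableIn {X : Set V} (h : ReachableIn G X v y) (hy : y ∈ C) :
    ∃ z, ∃ p : G.Walk v z, IsAccessPath C p ∧ ∀ w ∈ p.support, w ∈ X := by
  obtain ⟨p, hp⟩ := h
  obtain ⟨_, rfl, z, hz, q, hq, hqp, -, hqC⟩ := exists_isPath_between p (Set.mem_singleton v) hy
  exact ⟨z, q, ⟨hq, fun w hw ↦ ⟨hqC w hw, fun hwz ↦ hwz ▸ hz⟩⟩, fun w hw ↦ hp w (hqp hw)⟩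

/-- Walk from `w` back to `v` along `p`, jump to the first neighbour of `v` after `w`, and follow
`p` to its end. -/
theorem exists_isPath_through_neighbors {p : G.Walk v x} (hp : p.IsPath) (hvx : G.Adj v x)
    (hw : w ∈ p.support) (hwx : w ≠ x) :
    ∃ q : G.Walk w x, q.IsPath ∧ q.support ⊆ p.support ∧ v ∈ q.support ∧
      ∀ z ∈ p.support, G.Adj v z → z ∈ q.support := by
  obtain ⟨a, b, rfl⟩ := Walk.mem_support_iff_exists_append.1 hw
  cases b with
  | nil => exact absurd rfl hwx
  | @cons _ w' _ hww' b =>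
    obtain ⟨s, hs, d, e, rfl, hd⟩ :=
      exists_append_first_mem (B := {s | G.Adj v s}) b ⟨x, b.end_mem_support, hvx⟩
    have hb := (Walk.cons_isPath_iff _ _).1 hp.of_append_right
    have hwe : w ∉ e.support := fun hwe ↦ hb.2 ((Walk.mem_support_append_iff d e).2 (.inr hwe))
    have hdisj : ∀ z ∈ a.support, z ∉ e.support := by
      intro z hza hze
      have hzw : z = w := eq_of_mem_support_of_isPath_append hp hza <|
        List.mem_cons_of_mem _ ((Walk.mem_support_append_iff d e).2 (.inr hze))
      exact hwe (hzw ▸ hze)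
    refine ⟨a.reverse.append (e.cons hs), ?_, ?_, ?_, ?_⟩
    · refine isPath_append hp.of_append_left.reverse
        (hb.1.of_append_right.cons (hdisj v a.start_mem_support)) fun z hza hze ↦ ?_
      refine (List.mem_cons.1 hze).resolve_right (hdisj z (by simpa using hza))
    · intro z hz
      simp only [Walk.mem_support_append_iff, Walk.support_reverse, List.mem_reverse,
        Walk.support_cons, List.mem_cons] at hz ⊢
      rcases hz with hz | rfl | hz
      exacts [.inl hz, .inl a.start_mem_support, .inr (.inr (.inr hz))]
    · simp
    · intro z hz hvz
      simp only [Walk.mem_support_append_iff, Walk.support_reverse, List.mem_reverse,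
        Walk.support_cons, List.mem_cons] at hz ⊢
      rcases hz with hz | rfl | hz | hz
      · exact .inl hz
      · exact .inl a.end_mem_support
      · exact .inr (.inr (hd z hz hvz ▸ e.start_mem_support))
      · exact .inr (.inr hz)

theorem card_le_length_add_one {S : Finset V} {p : G.Walk u v}
    (h : ∀ z ∈ S, z ∈ p.support) : S.card ≤ p.length + 1 := by
  classical
  rw [← p.length_support]
  exact (Finset.card_le_card fun z hz ↦ List.mem_toFinset.2 (h z hz)).trans
    (List.toFinset_card_le p.support)

theorem isEar_append_append {x₁ x₂ : V} {p : G.Walk w x₁} {m : G.Walk w x} {q : G.Walk x x₂}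
    (hp : IsAccessPath C p) (hq : IsAccessPath C q) (hm : m.IsPath) (hmC : ∀ z ∈ m.support, z ∉ C)
    (hpq : p.support.Disjoint q.support) (hpm : ∀ z ∈ p.support, z ∈ m.support → z = w)
    (hmq : ∀ z ∈ m.support, z ∈ q.support → z = x) :
    IsEar C (p.reverse.append (m.append q)) where
  isPath := by
    refine isPath_append hp.isPath.reverse (isPath_append hm hq.isPath hmq) fun z hzp hz ↦ ?_
    rw [Walk.support_reverse, List.mem_reverse] at hzp
    rcases (Walk.mem_support_append_iff m q).1 hz with hz | hz
    exacts [hpm z hzp hz, absurd hz (hpq hzp)]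
  left_mem := hp.end_mem
  right_mem := hq.end_mem
  ne := by
    rintro rfl
    exact hpq p.end_mem_support q.end_mem_support
  eq_or_eq z hz hzC := by
    simp only [Walk.mem_support_append_iff, Walk.support_reverse, List.mem_reverse] at hz
    rcases hz with hz | hz | hz
    exacts [.inl ((hp.mem_iff z hz).1 hzC), absurd hzC (hmC z hz), .inr ((hq.mem_iff z hz).1 hzC)]

/-- Let `r` be the last vertex of `S` on the path and `T` the set of vertices before `r`. Two
disjoint paths from `r` and from `T` to `C` are joined through all vertices of `S`. -/
theorem IsAccessPath.exists_long_ear (h2 : IsTwoConnected G) (hC : C.Nontrivial)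
    {p : G.Walk v y} (hp : IsAccessPath C p) {S : Finset V} (hSne : S.Nonempty)
    (hS : ∀ z ∈ S, G.Adj v z ∧ z ∈ p.support ∧ z ∉ C) :
    ∃ x₁ x₂, ∃ q : G.Walk x₁ x₂, IsEar C q ∧ S.card + 2 ≤ q.length := by
  classical
  obtain ⟨s, hs⟩ := hSne
  obtain ⟨r, hrS, a, b, rfl, hb⟩ :=
    exists_append_last_mem (B := (S : Set V)) p ⟨s, (hS s hs).2.1, hs⟩
  obtain ⟨hvr, -, hrC⟩ := hS r hrS
  have hab {z : V} : z ∈ a.support → z ∈ b.support → z = r :=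
    eq_of_mem_support_of_isPath_append hp.isPath
  have haC : ∀ z ∈ a.support, z ∉ C := by
    intro z hz hzC
    obtain rfl := (hp.mem_iff z ((Walk.mem_support_append_iff a b).2 (.inl hz))).1 hzC
    exact hrC (hab hz b.end_mem_support ▸ hzC)
  have hSa : ∀ z ∈ S, z ∈ a.support := fun z hz ↦
    ((Walk.mem_support_append_iff a b).1 (hS z hz).2.1).elim id
      fun hzb ↦ hb z hzb hz ▸ a.end_mem_support
  obtain ⟨w, ⟨hwa, hwr⟩, x₁, hx₁, x₂, hx₂, p', q', hp', hq', hpq, hpT, hqT, hpC, hqC⟩ :=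
    h2.exists_disjoint_isPath (T := {z | z ∈ a.support ∧ z ≠ r}) hC
      ⟨v, a.start_mem_support, hvr.ne⟩ hp.end_mem ⟨b, fun z hzb hz ↦ hz.2 (hab hz.1 hzb)⟩
  obtain ⟨m, hm, hma, hvm, hNm⟩ :=
    exists_isPath_through_neighbors hp.isPath.of_append_left hvr hwa hwr
  have hrq : r ∈ q'.support := q'.start_mem_support
  refine ⟨x₁, x₂, _, isEar_append_append ⟨hp', fun z hz ↦ ⟨hpC z hz, fun h ↦ h ▸ hx₁⟩⟩
    ⟨hq', fun z hz ↦ ⟨hqC z hz, fun h ↦ h ▸ hx₂⟩⟩ hm (fun z hz ↦ haC z (hma hz)) hpq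
    (fun z hzp hzm ↦ hpT z hzp ⟨hma hzm, fun hzr ↦ hpq hzp (hzr ▸ hrq)⟩)
    (fun z hzm hzq ↦ not_imp_comm.1 (fun hzr ↦ ⟨hma hzm, hzr⟩) (hqT z hzq)), ?_⟩
  have hp1 : p'.length ≠ 0 := fun h ↦ haC w hwa (Walk.eq_of_length_eq_zero h ▸ hx₁)
  have hq1 : q'.length ≠ 0 := fun h ↦ hrC (Walk.eq_of_length_eq_zero h ▸ hx₂)
  have hmS : (insert v S).card ≤ m.length + 1 := card_le_length_add_one fun z hz ↦ by
    rcases Finset.mem_insert.1 hz with rfl | hz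
    exacts [hvm, hNm z (hSa z hz) (hS z hz).1]
  rw [Finset.card_insert_of_notMem fun hvS ↦ (hS v hvS).1.ne rfl] at hmS
  simp only [Walk.length_append, Walk.length_reverse]
  omega

end Ears

section LongestCycle

open SimpleGraph

variable {V : Type*} {G : SimpleGraph V} {u v w x y z : V}

theorem isCycle_append {p : G.Walk x y} {q : G.Walk y x} (hp : p.IsPath) (hq : q.IsPath)
    (h : ∀ z ∈ p.support, z ∈ q.support → z = x ∨ z = y) (hlen : 1 < p.length) :
    (p.append q).IsCycle := by
  refine hp.isCycle_append hq (fun z hzp hzq ↦ ?_) (.inl hlen)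
  have hp' : (x :: p.support.tail).Nodup := p.cons_tail_support ▸ hp.support_nodup
  have hq' : (y :: q.support.tail).Nodup := q.cons_tail_support ▸ hq.support_nodup
  rcases h z (List.mem_of_mem_tail hzp) (List.mem_of_mem_tail hzq) with rfl | rfl
  exacts [(List.nodup_cons.1 hp').1 hzp, (List.nodup_cons.1 hq').1 hzq]

/-- A cycle of maximum length in `G`. -/
def IsLongestCycle (c : G.Walk u u) : Prop :=
  c.IsCycle ∧ ∀ x (d : G.Walk x x), d.IsCycle → d.length ≤ c.length

namespace IsLongestCycle

variable {c : G.Walk u u}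

theorem nontrivial (h : IsLongestCycle c) : {z | z ∈ c.support}.Nontrivial :=
  ⟨u, c.start_mem_support, c.snd, c.getVert_mem_support 1, (c.adj_snd h.1.not_nil).ne⟩

theorem append_comm {α : G.Walk x y} {β : G.Walk y x} (h : IsLongestCycle (α.append β)) :
    IsLongestCycle (β.append α) := by
  refine ⟨isCycle_append_comm h.1, fun v d hd ↦ (h.2 v d hd).trans_eq ?_⟩
  rw [Walk.length_append, Walk.length_append, Nat.add_comm]

theorem reverse (h : IsLongestCycle c) : IsLongestCycle c.reverse :=
  ⟨h.1.reverse, c.length_reverse.symm ▸ h.2⟩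

theorem length_ear_le_length {α : G.Walk x y} {β : G.Walk y x} {p : G.Walk x y}
    (h : IsLongestCycle (α.append β)) (hp : IsEar {z | z ∈ (α.append β).support} p) :
    p.length ≤ α.length := by
  have hα : ¬ α.Nil := fun hnil ↦ hp.ne hnil.eq
  by_contra! hlt
  have hα1 : α.length ≠ 0 := fun h0 ↦ hα (Walk.length_eq_zero_iff.1 h0)
  have hcycle : (p.append β).IsCycle := isCycle_append hp.isPath (h.1.isPath_of_append_right hα)
    (fun z hzp hzβ ↦ hp.eq_or_eq z hzp ((Walk.mem_support_append_iff α β).2 (.inr hzβ))) (by omega)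
  have hle := h.2 _ _ hcycle
  simp only [Walk.length_append] at hle
  omega

theorem exists_rotation (h : IsLongestCycle c) (hx : x ∈ c.support) :
    ∃ d : G.Walk x x, IsLongestCycle d ∧ {z | z ∈ d.support} = {z | z ∈ c.support} ∧
      d.length = c.length ∧ d.support.tail ~r c.support.tail := by
  classical
  refine ⟨c.rotate x hx, ⟨(Walk.isCycle_rotate hx).2 h.1, ?_⟩,
    Set.ext fun z ↦ Walk.mem_support_rotate_iff c x hx, c.length_rotate x hx,
    Walk.support_rotate c x hx⟩
  rw [Walk.length_rotate]
  exact h.2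

theorem length_ear_le_length_right {α : G.Walk x y} {β : G.Walk y x} {p : G.Walk x y}
    (h : IsLongestCycle (α.append β)) (hp : IsEar {z | z ∈ (α.append β).support} p) :
    p.length ≤ β.length := by
  have hC : {z | z ∈ (α.append β).support} = {z | z ∈ (β.append α).support} := by
    ext z
    simp only [Set.mem_ofPred_eq, Walk.mem_support_append_iff, or_comm]
  have hle := h.append_comm.length_ear_le_length (hC ▸ hp).reverse
  rwa [Walk.length_reverse] at hle

theorem two_mul_length_ear_le (h : IsLongestCycle c) {p : G.Walk x y}
    (hp : IsEar {z | z ∈ c.support} p) : 2 * p.length ≤ c.length := by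
  obtain ⟨d, hd, hdC, hdlen, -⟩ := h.exists_rotation hp.left_mem
  rw [← hdC] at hp
  obtain ⟨α, β, rfl⟩ := Walk.mem_support_iff_exists_append.1 hp.right_mem
  have hα := hd.length_ear_le_length hp
  have hβ := hd.length_ear_le_length_right hp
  rw [← hdlen, Walk.length_append]
  omega

theorem not_adj_of_adj {α : G.Walk u x} {hxy : G.Adj x y} {β : G.Walk y u}
    (h : IsLongestCycle (α.append (β.cons hxy))) (hv : v ∉ (α.append (β.cons hxy)).support)
    (hvx : G.Adj v x) : ¬ G.Adj v y := by
  intro hvy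
  have hC : {z | z ∈ (α.append (β.cons hxy)).support} =
      {z | z ∈ (hxy.toWalk.append (β.append α)).support} := by
    ext z
    simp only [Walk.mem_support_append_iff, Walk.support_cons, List.mem_cons, Set.mem_ofPred_eq,
      Walk.cons_append, Walk.nil_append]
    tauto
  have h' : IsLongestCycle (hxy.toWalk.append (β.append α)) := h.append_comm
  have hp := (IsAccessPath.of_adj (C := {z | z ∈ (α.append (β.cons hxy)).support}) hv
    (by simp) hvy).isEar_cons (by simp) hxy.ne hvx.symm
  have hle := h'.length_ear_le_length (hC ▸ hp)
  simp at hle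

theorem not_adj_of_adj_of_adj {a a' b b' : V} {ha : G.Adj a a'} {hb : G.Adj b b'}
    {μ : G.Walk a' b} {β : G.Walk b' a} (h : IsLongestCycle ((μ.append (β.cons hb)).cons ha))
    (hv : v ∉ ((μ.append (β.cons hb)).cons ha).support) (hab : a ≠ b) (hva : G.Adj v a)
    (hvb : G.Adj v b) : ¬ G.Adj a' b' := by
  intro hadj
  -- `a v b ⋯ a' b' ⋯ a` would be a longer cycle
  let p : G.Walk a b := .cons hva.symm hvb.toWalk
  let q : G.Walk b a := μ.reverse.append (β.cons hadj)
  have hsupp : (μ.support ++ β.support).Nodup := by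
    simpa [Walk.support_append] using h.1.support_nodup
  have hp : p.IsPath := by
    simp [p, Walk.isPath_def, hva.ne', hvb.ne, hab]
  have hq : q.IsPath := by
    simpa [q, Walk.isPath_def, Walk.support_append, List.nodup_append] using hsupp
  have hvq : v ∉ q.support := by
    simp only [q, Walk.support_cons, Walk.support_append, List.tail_cons, List.mem_cons,
      List.mem_append, not_or, Walk.support_reverse, List.mem_reverse] at hv ⊢
    tauto
  have hcycle : (p.append q).IsCycle := by
    refine isCycle_append hp hq (fun z hzp hzq ↦ ?_) (by simp [p])
    have hz : z = a ∨ z = v ∨ z = b := by simpa [p] using hzp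
    rcases hz with rfl | rfl | rfl
    exacts [.inl rfl, (hvq hzq).elim, .inr rfl]
  have hle := h.2 a _ hcycle
  simp [p, q] at hle

end IsLongestCycle

theorem two_mul_card_le_of_forall_succ_notMem {S : Finset ℕ} {a b : ℕ} (hS : S ⊆ Finset.Icc a b)
    (hsucc : ∀ i ∈ S, i + 1 ∉ S) : 2 * S.card ≤ b + 2 - a := by
  have hdisj : Disjoint S (S.image (· + 1)) := by
    rw [Finset.disjoint_right]
    rintro j hj
    obtain ⟨i, hi, rfl⟩ := Finset.mem_image.1 hj
    exact hsucc i hi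
  have hsub : S ∪ S.image (· + 1) ⊆ Finset.Icc a (b + 1) := by
    intro j hj
    rcases Finset.mem_union.1 hj with hj | hj
    · have := Finset.mem_Icc.1 (hS hj)
      exact Finset.mem_Icc.2 (by omega)
    · obtain ⟨i, hi, rfl⟩ := Finset.mem_image.1 hj
      have := Finset.mem_Icc.1 (hS hi)
      exact Finset.mem_Icc.2 (by omega)
  have hcard := Finset.card_le_card hsub
  rw [Finset.card_union_of_disjoint hdisj, Finset.card_image_of_injective S
    (add_left_injective 1), Nat.card_Icc] at hcard
  omega

namespace IsLongestCycle

variable {c : G.Walk u u}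

theorem not_adj_getVert_succ (h : IsLongestCycle c) (hv : v ∉ c.support) {i : ℕ}
    (hi : i < c.length) (hvi : G.Adj v (c.getVert i)) : ¬ G.Adj v (c.getVert (i + 1)) := by
  obtain ⟨α, β, hαβ, hα⟩ := exists_append_of_le_length c hi.le
  have hsucc : c.getVert (i + 1) = β.getVert 1 := by
    conv_lhs => rw [hαβ, Walk.getVert_append, hα]
    simp
  rw [hsucc]
  generalize c.getVert i = x at *
  subst hαβ
  cases β with
  | nil => simp [hα] at hi
  | cons hxy β =>
    rw [Walk.getVert_cons_succ, Walk.getVert_zero]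
    exact h.not_adj_of_adj hv hvi

theorem getVert_index_bounds (h : IsLongestCycle c) {p : G.Walk v u}
    (hp : IsAccessPath {z | z ∈ c.support} p) {i : ℕ} (hi : i ≤ c.length)
    (hvi : G.Adj v (c.getVert i)) (hne : c.getVert i ≠ u) :
    p.length + 1 ≤ i ∧ p.length + 1 + i ≤ c.length := by
  have hear := hp.isEar_cons (c.getVert_mem_support i) hne hvi.symm
  obtain ⟨α, β, hαβ, hα⟩ := exists_append_of_le_length c hi
  generalize c.getVert i = x at *
  subst hαβ
  have h₁ := h.length_ear_le_length hear.reverse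
  have h₂ := h.length_ear_le_length_right hear.reverse
  simp only [Walk.length_reverse, Walk.length_cons, Walk.length_append] at h₁ h₂ ⊢
  omega

theorem two_mul_length_add_card_le (h : IsLongestCycle c) {p : G.Walk v y} (hv : v ∉ c.support)
    (hp : IsAccessPath {z | z ∈ c.support} p) {S : Finset V} (hSne : S.Nonempty)
    (hS : ∀ x ∈ S, x ∈ c.support ∧ x ≠ y ∧ G.Adj v x) :
    2 * (p.length + S.card) ≤ c.length := by
  classical
  obtain ⟨d, hd, hdC, hdlen, -⟩ := h.exists_rotation hp.end_mem
  have hmem (z : V) : z ∈ d.support ↔ z ∈ c.support := Set.ext_iff.1 hdC z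
  rw [← hdC] at hp
  let I : Finset ℕ := (Finset.range (d.length + 1)).filter fun i ↦ d.getVert i ∈ S
  have hI (i : ℕ) (hi : i ∈ I) : i ≤ d.length ∧ d.getVert i ∈ S := by
    simpa only [I, Finset.mem_filter, Finset.mem_range, Nat.lt_succ_iff] using hi
  have hbounds (i : ℕ) (hi : i ∈ I) : p.length + 1 ≤ i ∧ p.length + 1 + i ≤ d.length :=
    let ⟨_, hne, hadj⟩ := hS _ (hI i hi).2
    hd.getVert_index_bounds hp (hI i hi).1 hadj hne
  have hSI : S ⊆ I.image d.getVert := by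
    intro x hx
    obtain ⟨i, rfl, hi⟩ := Walk.mem_support_iff_exists_getVert.1 ((hmem x).2 (hS x hx).1)
    exact Finset.mem_image_of_mem _ (by simpa [I, Nat.lt_succ_iff, hx] using hi)
  have hSI' : S.card ≤ I.card := (Finset.card_le_card hSI).trans Finset.card_image_le
  have hI2 : 2 * I.card ≤ d.length - (p.length + 1) + 2 - (p.length + 1) := by
    refine two_mul_card_le_of_forall_succ_notMem (fun i hi ↦ ?_) fun i hi hi' ↦ ?_
    · have := hbounds i hi
      exact Finset.mem_Icc.2 (by omega)
    · have hlt : i < d.length := (hI _ hi').1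
      exact hd.not_adj_getVert_succ (mt (hmem v).1 hv) hlt (hS _ (hI i hi).2).2.2
        (hS _ (hI _ hi').2).2.2
  have hSpos := hSne.card_pos
  omega

end IsLongestCycle

end LongestCycle

section EdgeCounting

variable {V : Type*} (G : SimpleGraph V)

open Classical in
/-- The number of neighbours of `v` in `S`. -/
noncomputable def degIn (v : V) (S : Finset V) : ℕ := (S.filter (G.Adj v)).card

variable {G}

theorem degIn_union {S T : Finset V} [DecidableEq V] (h : Disjoint S T) (v : V) :
    degIn G v (S ∪ T) = degIn G v S + degIn G v T := by
  classical
  unfold degIn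
  rw [Finset.filter_union, Finset.card_union_of_disjoint (Finset.disjoint_filter_filter h)]

theorem degIn_sdiff_add {S D : Finset V} [DecidableEq V] (h : S ⊆ D) (v : V) :
    degIn G v S + degIn G v (D \ S) = degIn G v D := by
  rw [← degIn_union Finset.disjoint_sdiff, Finset.union_sdiff_of_subset h]

theorem degIn_le_card (v : V) (S : Finset V) : degIn G v S ≤ S.card := by
  classical
  exact Finset.card_filter_le _ _

theorem degIn_lt_card {v : V} {S : Finset V} (hv : v ∈ S) : degIn G v S < S.card := by
  classical
  exact Finset.card_lt_card (Finset.filter_ssubset.2 ⟨v, hv, G.irrefl⟩)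

theorem degIn_eq_zero {v : V} {S : Finset V} : degIn G v S = 0 ↔ ∀ w ∈ S, ¬ G.Adj v w := by
  classical
  simp [degIn, Finset.filter_eq_empty_iff]

theorem sum_degIn_comm (S T : Finset V) :
    ∑ v ∈ S, degIn G v T = ∑ w ∈ T, degIn G w S := by
  classical
  simp only [degIn, Finset.card_filter]
  rw [Finset.sum_comm]
  simp only [G.adj_comm]

end EdgeCounting

section OutsideDegrees

open SimpleGraph

variable {V : Type*} {G : SimpleGraph V} {u v w x y : V} {t : ℕ}

/-- An access path to `C` of maximum length among those starting in `D`. -/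
structure IsLongestAccessPath (C : Set V) (D : Finset V) (p : G.Walk v y) : Prop
    extends IsAccessPath C p where
  start_mem : v ∈ D
  length_le : ∀ v' ∈ D, ∀ y' (q : G.Walk v' y'), IsAccessPath C q → q.length ≤ p.length

theorem exists_isLongestAccessPath [Finite V] {C : Set V} {D : Finset V} (hv : v ∈ D)
    {p : G.Walk v y} (hp : IsAccessPath C p) :
    ∃ v' y', ∃ q : G.Walk v' y', IsLongestAccessPath C D q ∧ p.length ≤ q.length := by
  let lengths : Set ℕ := {n | ∃ v ∈ D, ∃ y, ∃ p : G.Walk v y, IsAccessPath C p ∧ p.length = n}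
  have hbdd : BddAbove lengths := by
    cases nonempty_fintype V
    refine ⟨Fintype.card V, ?_⟩
    rintro _ ⟨v, -, y, p, hp, rfl⟩
    exact hp.isPath.length_lt.le
  have hmem : p.length ∈ lengths := ⟨v, hv, y, p, hp, rfl⟩
  obtain ⟨v', hv', y', q, hq, hqlen⟩ := Nat.sSup_mem ⟨_, hmem⟩ hbdd
  refine ⟨v', y', q, ⟨hq, hv', fun v'' hv'' y'' q' hq' ↦ ?_⟩, hqlen ▸ le_csSup hbdd hmem⟩
  exact hqlen ▸ le_csSup hbdd ⟨v'', hv'', y'', q', hq', rfl⟩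

theorem IsTwoConnected.exists_isAccessPath (h2 : IsTwoConnected G) {C : Set V}
    (hC : C.Nonempty) (hv : v ∉ C) (hw : w ∉ C) (hvw : G.Adj v w) :
    ∃ y, ∃ p : G.Walk v y, IsAccessPath C p ∧ 2 ≤ p.length := by
  obtain ⟨x, hx⟩ := hC
  obtain ⟨y, p, hp, hpv⟩ := exists_isAccessPath_of_reachableIn
    (h2.reachableIn_compl hvw.ne' (ne_of_mem_of_not_mem hx hv)) hx
  refine ⟨y, p.cons hvw, hp.cons (fun hvp ↦ hpv v hvp rfl) hv hvw, ?_⟩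
  have hlen : p.length ≠ 0 := fun h0 ↦ hw (Walk.eq_of_length_eq_zero h0 ▸ hp.end_mem)
  rw [Walk.length_cons]
  omega

namespace IsLongestAccessPath

variable {C : Set V} {D : Finset V} {p : G.Walk v y}

theorem mem_support_of_adj (hp : IsLongestAccessPath C D p) (hD : ∀ z ∈ D, z ∉ C) (hu : u ∈ D)
    (hvu : G.Adj v u) : u ∈ p.support := by
  by_contra hup
  have hle := hp.length_le u hu y _ (hp.cons hup (hD u hu) hvu.symm)
  simp at hle

theorem exists_rotation (hp : IsLongestAccessPath C D p)
    (hadj : ∀ z ∈ p.support, z ≠ v → G.Adj v z) (hu : u ∈ p.support) (huD : u ∈ D) (huy : u ≠ y) :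
    ∃ q : G.Walk u y, IsLongestAccessPath C D q ∧ q.length = p.length ∧
      ∀ z, z ∈ q.support ↔ z ∈ p.support := by
  have hvy : y ≠ v := by
    rintro rfl
    rw [Walk.nil_iff_support_eq.1 (Walk.isPath_iff_nil.1 hp.isPath), List.mem_singleton] at hu
    exact huy hu
  obtain ⟨q, hq, hqp, hvq, hNq⟩ :=
    exists_isPath_through_neighbors hp.isPath (hadj y p.end_mem_support hvy) hu huy
  have hsupp (z : V) : z ∈ q.support ↔ z ∈ p.support :=
    ⟨fun hz ↦ hqp hz, fun hz ↦ (eq_or_ne z v).elim (fun h ↦ h ▸ hvq)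
      fun h ↦ hNq z hz (hadj z hz h)⟩
  have hlen : q.length = p.length := by
    have hperm := (List.perm_ext_iff_of_nodup hq.support_nodup hp.isPath.support_nodup).2 hsupp
    simpa using hperm.length_eq
  exact ⟨q, ⟨⟨hq, fun z hz ↦ hp.mem_iff z (hqp hz)⟩, huD, hlen ▸ hp.length_le⟩, hlen, hsupp⟩

end IsLongestAccessPath

variable [DecidableEq V]

theorem IsLongestCycle.two_mul_degIn_le {c : G.Walk u u} (hc : IsLongestCycle c)
    (hv : v ∉ c.support) : 2 * degIn G v c.support.toFinset ≤ c.length := by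
  classical
  have hthree := hc.1.three_le_length
  by_cases hdeg : degIn G v c.support.toFinset ≤ 1
  · omega
  obtain ⟨y, hy⟩ : (c.support.toFinset.filter (G.Adj v)).Nonempty :=
    Finset.card_pos.1 (by unfold degIn at hdeg; omega)
  obtain ⟨hyC, hvy⟩ := Finset.mem_filter.1 hy
  have hcard := Finset.card_erase_of_mem hy
  have hle := hc.two_mul_length_add_card_le hv
    (IsAccessPath.of_adj (C := {z | z ∈ c.support}) hv (List.mem_toFinset.1 hyC) hvy)
    (S := (c.support.toFinset.filter (G.Adj v)).erase y)
    (Finset.card_pos.1 (by unfold degIn at hdeg; omega)) fun x hx ↦ by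
      simpa [and_assoc, and_comm, and_left_comm] using hx
  unfold degIn at hdeg ⊢
  simp only [Walk.length_cons, Walk.length_nil] at hle
  omega

theorem card_toFinset_support_erase {p : G.Walk v y} (hp : p.IsPath) (hu : u ∈ p.support) :
    (p.support.toFinset.erase u).card = p.length := by
  rw [Finset.card_erase_of_mem (List.mem_toFinset.2 hu),
    List.toFinset_card_of_nodup hp.support_nodup, Walk.length_support, Nat.add_sub_cancel]

namespace IsLongestAccessPath

variable {c : G.Walk x x} {D : Finset V} {p : G.Walk v y}

/-- Otherwise all neighbours of `v` but at most one lie on the path, which yields a long ear. -/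
theorem exists_adj_ne_end (h2 : IsTwoConnected G) (ht : 2 ≤ t) (hc : IsLongestCycle c)
    (hct : c.length ≤ 2 * t + 1) (hD : ∀ z ∈ D, z ∉ c.support)
    (hp : IsLongestAccessPath {z | z ∈ c.support} D p)
    (hdeg : t ≤ degIn G v D + degIn G v c.support.toFinset) :
    ∃ z ∈ c.support, z ≠ y ∧ G.Adj v z := by
  classical
  by_contra! hN
  have hdegC : degIn G v c.support.toFinset ≤ ({y} : Finset V).card :=
    Finset.card_le_card fun z hz ↦ by
      obtain ⟨hzc, hvz⟩ := Finset.mem_filter.1 hz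
      exact Finset.mem_singleton.2 (not_imp_comm.1 (hN z (List.mem_toFinset.1 hzc)) (not_not.2 hvz))
  rw [Finset.card_singleton] at hdegC
  have hdegD : t ≤ (D.filter (G.Adj v)).card + degIn G v c.support.toFinset := hdeg
  obtain ⟨x₁, x₂, q, hq, hqlen⟩ := hp.exists_long_ear h2 hc.nontrivial
    (S := D.filter (G.Adj v)) (Finset.card_pos.1 (by omega)) fun z hz ↦ by
      obtain ⟨hz, hvz⟩ := Finset.mem_filter.1 hz
      exact ⟨hvz, hp.mem_support_of_adj hD hz hvz, hD z hz⟩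
  have := hc.two_mul_length_ear_le hq
  omega

/-- At the start of a longest access path, all the bounds on the numbers of neighbours on the path
and on the cycle are attained. -/
theorem forall_mem_and_forall_adj_and_degIn_add_length_eq (h2 : IsTwoConnected G) (ht : 2 ≤ t)
    (hc : IsLongestCycle c) (hct : c.length ≤ 2 * t + 1) (hD : ∀ z ∈ D, z ∉ c.support)
    (hp : IsLongestAccessPath {z | z ∈ c.support} D p)
    (hdeg : t ≤ degIn G v D + degIn G v c.support.toFinset) :
    (∀ z ∈ p.support, z ≠ y → z ∈ D) ∧ (∀ z ∈ p.support, z ≠ v → G.Adj v z) ∧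
      degIn G v c.support.toFinset + p.length = t + 1 := by
  classical
  obtain ⟨x', hx', hx'y, hvx'⟩ := hp.exists_adj_ne_end h2 ht hc hct hD hdeg
  have hv := hD v hp.start_mem
  have hyc : y ∈ c.support := hp.end_mem
  let N := (c.support.toFinset.filter (G.Adj v)).erase y
  have hlen : 2 * (p.length + N.card) ≤ c.length :=
    hc.two_mul_length_add_card_le hv hp.toIsAccessPath
      ⟨x', by simp [N, hx', hx'y, hvx']⟩ fun z hz ↦ by
        simpa [N, and_assoc, and_comm, and_left_comm] using hz
  have hsub : D.filter (G.Adj v) ⊆ (p.support.toFinset.erase y).erase v := fun z hz ↦ by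
    obtain ⟨hz, hvz⟩ := Finset.mem_filter.1 hz
    simpa using ⟨hvz.ne', (ne_of_mem_of_not_mem hyc (hD z hz)).symm,
      hp.mem_support_of_adj hD hz hvz⟩
  have hcard : ((p.support.toFinset.erase y).erase v).card + 1 = p.length := by
    rw [Finset.card_erase_add_one (by simpa using (ne_of_mem_of_not_mem hyc hv).symm),
      card_toFinset_support_erase hp.isPath p.end_mem_support]
  have hdegD : degIn G v D = (D.filter (G.Adj v)).card := rfl
  have hdegC : degIn G v c.support.toFinset = (c.support.toFinset.filter (G.Adj v)).card := rfl
  have hle := Finset.card_le_card hsub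
  have hNcard : (c.support.toFinset.filter (G.Adj v)).card - 1 ≤ N.card :=
    Finset.pred_card_le_card_erase
  have hmem {z : V} (hz : z ∈ p.support) (hzv : z ≠ v) (hzy : z ≠ y) : z ∈ D ∧ G.Adj v z := by
    rw [← Finset.mem_filter, Finset.eq_of_subset_of_card_le hsub (by omega)]
    simp [*]
  have hvy : G.Adj v y := by
    by_contra hvy
    have hN : N = c.support.toFinset.filter (G.Adj v) :=
      Finset.erase_eq_of_notMem (by simp [hvy])
    rw [hN] at hlen
    omega
  refine ⟨fun z hz hzy ↦ ?_, fun z hz hzv ↦ ?_, by omega⟩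
  · exact (eq_or_ne z v).elim (fun h ↦ h ▸ hp.start_mem) fun hzv ↦ (hmem hz hzv hzy).1
  · exact (eq_or_ne z y).elim (fun h ↦ h ▸ hvy) fun hzy ↦ (hmem hz hzv hzy).2

end IsLongestAccessPath

theorem exists_sparse_subset (h2 : IsTwoConnected G) {c : G.Walk x x} (ht : 2 ≤ t)
    (hc : IsLongestCycle c) (hct : c.length ≤ 2 * t + 1) {D : Finset V} (hD₀ : D.Nonempty)
    (hD : ∀ v ∈ D, v ∉ c.support) (hD' : ∀ v ∈ D, ∃ w ∉ c.support, G.Adj v w) :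
    ∃ S ⊆ D, S.Nonempty ∧
      ∑ v ∈ S, (degIn G v S + 2 * degIn G v (D \ S) + 2 * degIn G v c.support.toFinset) ≤
        (2 * t - 1) * S.card := by
  by_cases hdeg : ∃ v ∈ D, degIn G v D + degIn G v c.support.toFinset < t
  · obtain ⟨v, hv, hlt⟩ := hdeg
    have hsplit := degIn_sdiff_add (G := G) (Finset.singleton_subset_iff.2 hv) v
    refine ⟨{v}, by simpa using hv, by simp, ?_⟩
    simp only [Finset.sum_singleton, Finset.card_singleton]
    omega
  push Not at hdeg
  obtain ⟨v₀, hv₀⟩ := hD₀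
  obtain ⟨w₀, hw₀, hvw₀⟩ := hD' v₀ hv₀
  obtain ⟨y₀, p₀, hp₀, hlen₀⟩ :=
    h2.exists_isAccessPath (C := {z | z ∈ c.support}) hc.nontrivial.nonempty (hD v₀ hv₀) hw₀ hvw₀
  have := h2.finite
  obtain ⟨v, y, p, hp, hlen⟩ := exists_isLongestAccessPath hv₀ hp₀
  have hyc : y ∈ c.support := hp.end_mem
  obtain ⟨hpD, hadj, -⟩ := hp.forall_mem_and_forall_adj_and_degIn_add_length_eq h2 ht hc hct hD
    (hdeg v hp.start_mem)
  have hSD : p.support.toFinset.erase y ⊆ D := fun z hz ↦ by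
    rw [Finset.mem_erase, List.mem_toFinset] at hz
    exact hpD z hz.2 hz.1
  have hScard := card_toFinset_support_erase hp.isPath p.end_mem_support
  refine ⟨p.support.toFinset.erase y, hSD, Finset.card_pos.1 (by omega), ?_⟩
  rw [mul_comm, ← smul_eq_mul]
  refine Finset.sum_le_card_nsmul _ _ _ fun u hu ↦ ?_
  obtain ⟨huy, hup⟩ : u ≠ y ∧ u ∈ p.support := by simpa using hu
  obtain ⟨q, hq, hqlen, hqp⟩ := hp.exists_rotation hadj hup (hSD hu) huy
  obtain ⟨-, -, hsum⟩ := hq.forall_mem_and_forall_adj_and_degIn_add_length_eq h2 ht hc hct hD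
    (hdeg u (hSD hu))
  have hout : degIn G u (D \ p.support.toFinset.erase y) = 0 := degIn_eq_zero.2 fun w hw huw ↦ by
    obtain ⟨hwD, hwS⟩ := Finset.mem_sdiff.1 hw
    exact hwS <| Finset.mem_erase.2 ⟨(ne_of_mem_of_not_mem hyc (hD w hwD)).symm,
      List.mem_toFinset.2 ((hqp w).1 (hq.mem_support_of_adj hD hwD huw))⟩
  have hin := degIn_lt_card (G := G) hu
  omega

theorem sum_degIn_add_two_mul_degIn_le (h2 : IsTwoConnected G) {c : G.Walk x x}
    (ht : 2 ≤ t) (hc : IsLongestCycle c) (hct : c.length ≤ 2 * t + 1) {D : Finset V}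
    (hD : ∀ v ∈ D, v ∉ c.support) (hD' : ∀ v ∈ D, ∃ w ∉ c.support, G.Adj v w) :
    ∑ v ∈ D, (degIn G v D + 2 * degIn G v c.support.toFinset) ≤ (2 * t - 1) * D.card := by
  induction D using Finset.strongInduction with
  | H D ih =>
    rcases D.eq_empty_or_nonempty with rfl | hD₀
    · simp
    obtain ⟨S, hSD, hS₀, hS⟩ := exists_sparse_subset h2 ht hc hct hD₀ hD hD'
    have hrest := ih (D \ S) (Finset.sdiff_ssubset hSD hS₀)
      (fun v hv ↦ hD v (Finset.sdiff_subset hv)) fun v hv ↦ hD' v (Finset.sdiff_subset hv)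
    have hsplit : ∑ v ∈ D, (degIn G v D + 2 * degIn G v c.support.toFinset) =
        ∑ v ∈ S, (degIn G v S + 2 * degIn G v (D \ S) + 2 * degIn G v c.support.toFinset) +
        ∑ v ∈ D \ S, (degIn G v (D \ S) + 2 * degIn G v c.support.toFinset) := by
      have hcross := sum_degIn_comm (G := G) (D \ S) S
      rw [← Finset.sum_sdiff hSD]
      simp only [← degIn_sdiff_add hSD, Finset.sum_add_distrib, ← Finset.mul_sum]
      omega
    rw [hsplit, ← Finset.card_sdiff_add_card_eq_card hSD, mul_add]
    omega

end OutsideDegrees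

section ExistenceOfCycles

open SimpleGraph

variable {V : Type*} {G : SimpleGraph V} {u x : V}

namespace IsTwoConnected

theorem exists_adj_ne (h : IsTwoConnected G) (hxu : x ≠ u) : ∃ y ≠ u, G.Adj x y := by
  have := h.finite
  obtain ⟨z, hzx, hzu⟩ := ENat.exists_ne_ne_of_three_le (α := V)
    (by rw [ENat.card_eq_coe_natCard]; exact_mod_cast h.1) x u
  obtain ⟨p, hp⟩ := h.reachableIn_compl hxu hzu
  exact ⟨p.snd, hp _ (p.getVert_mem_support 1), p.adj_snd fun hnil ↦ hzx hnil.eq.symm⟩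

theorem exists_isCycle (h : IsTwoConnected G) : ∃ x, ∃ c : G.Walk x x, c.IsCycle := by
  classical
  have := h.finite
  have : Nontrivial V := Finite.one_lt_card_iff_nontrivial.1 (by have := h.1; omega)
  obtain ⟨x, y, hxy⟩ := exists_pair_ne V
  obtain ⟨a, -, hxa⟩ := h.exists_adj_ne hxy
  obtain ⟨b, hba, hxb⟩ := h.exists_adj_ne hxa.ne
  obtain ⟨p, hp⟩ := h.reachableIn_compl hxa.ne' hxb.ne'
  have hxp : x ∉ p.bypass.support := fun hx ↦ hp x (p.support_bypass_subset_support hx) rfl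
  have hlen : p.bypass.length ≠ 0 := fun h0 ↦ hba (Walk.eq_of_length_eq_zero h0).symm
  refine ⟨x, (p.bypass.cons hxa).append hxb.symm.toWalk, isCycle_append
    (p.bypass_isPath.cons hxp) (.of_adj hxb.symm) (fun z _ hz ↦ ?_) ?_⟩
  · simpa [or_comm] using hz
  · rw [Walk.length_cons]
    omega

theorem exists_isLongestCycle (h : IsTwoConnected G) :
    ∃ x, ∃ c : G.Walk x x, IsLongestCycle c := by
  let lengths : Set ℕ := {n | ∃ x, ∃ c : G.Walk x x, c.IsCycle ∧ c.length = n}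
  have hbdd : BddAbove lengths := by
    have := h.finite
    cases nonempty_fintype V
    refine ⟨Fintype.card V, ?_⟩
    rintro _ ⟨x, c, hc, rfl⟩
    simpa using hc.support_nodup.length_le_card
  obtain ⟨x, c, hc⟩ := h.exists_isCycle
  have hmem : c.length ∈ lengths := ⟨x, c, hc, rfl⟩
  obtain ⟨x', c', hc', hlen⟩ := Nat.sSup_mem ⟨_, hmem⟩ hbdd
  exact ⟨x', c', hc', fun y d hd ↦ hlen ▸ le_csSup hbdd ⟨y, d, hd, rfl⟩⟩

end IsTwoConnected

end ExistenceOfCycles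

section CycleSuccessor

open SimpleGraph

variable {V : Type*} {G : SimpleGraph V}

theorem sum_degIn_le_two {B : Finset V} {u w : V}
    (h : ∀ x ∈ B, ∀ y ∈ B, G.Adj x y → s(x, y) = s(u, w)) : ∑ x ∈ B, degIn G x B ≤ 2 := by
  classical
  have hsub : {e ∈ B ×ˢ B | G.Adj e.1 e.2} ⊆ {(u, w), (w, u)} := by
    rintro ⟨x, y⟩ hxy
    obtain ⟨hmem, hadj⟩ := Finset.mem_filter.1 hxy
    obtain ⟨hx, hy⟩ := Finset.mem_product.1 hmem
    simpa using h x hx y hy hadj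
  calc ∑ x ∈ B, degIn G x B = {e ∈ B ×ˢ B | G.Adj e.1 e.2}.card := by
        simp only [degIn, Finset.card_filter, Finset.sum_product]
    _ ≤ 2 := (Finset.card_le_card hsub).trans Finset.card_le_two

theorem inv_apply_mem_of_card_le_add_one {σ : Equiv.Perm V} {A B : Finset V} {w x : V}
    (hσ : ∀ a ∈ A, σ a ∈ B) (hcard : B.card ≤ A.card + 1) (hw : w ∈ B) (hwA : σ⁻¹ w ∉ A)
    (hx : x ∈ B) (hxw : x ≠ w) : σ⁻¹ x ∈ A := by
  classical
  have hwσ : w ∉ A.map σ.toEmbedding := by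
    rwa [Finset.mem_map_equiv]
  have hsub : insert w (A.map σ.toEmbedding) ⊆ B :=
    Finset.insert_subset hw fun y hy ↦ by
      obtain ⟨a, ha, rfl⟩ := Finset.mem_map.1 hy
      exact hσ a ha
  have heq := Finset.eq_of_subset_of_card_le hsub (by
    rwa [Finset.card_insert_of_notMem hwσ, Finset.card_map])
  rw [← heq, Finset.mem_insert] at hx
  exact Finset.mem_map_equiv.1 (hx.resolve_left hxw)

theorem sum_degIn_sdiff_le_two [DecidableEq V] {σ : Equiv.Perm V} {A C : Finset V}
    (hcard : (C \ A).card ≤ A.card + 1) (hA : ∀ a ∈ A, σ a ∈ C \ A)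
    (hA' : ∀ a ∈ A, σ⁻¹ a ∈ C \ A) (hC : ∀ x ∈ C, σ⁻¹ x ∈ C) (hfix : ∀ x ∈ C, σ⁻¹ x ≠ x)
    (hind : ∀ a ∈ A, ∀ b ∈ A, ¬ G.Adj (σ a) (σ b))
    (hind' : ∀ a ∈ A, ∀ b ∈ A, ¬ G.Adj (σ⁻¹ a) (σ⁻¹ b)) :
    ∑ x ∈ C \ A, degIn G x (C \ A) ≤ 2 := by
  have hnot {x y : V} (hx : σ⁻¹ x ∈ A) (hy : σ⁻¹ y ∈ A) : ¬ G.Adj x y := by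
    simpa using hind _ hx _ hy
  have hnot' {x y : V} (hx : σ x ∈ A) (hy : σ y ∈ A) : ¬ G.Adj x y := by
    simpa using hind' _ hx _ hy
  by_cases hall : ∀ x ∈ C \ A, σ⁻¹ x ∈ A
  · have hzero : ∑ x ∈ C \ A, degIn G x (C \ A) = 0 := Finset.sum_eq_zero fun x hx ↦
      degIn_eq_zero.2 fun y hy ↦ hnot (hall x hx) (hall y hy)
    omega
  push Not at hall
  obtain ⟨w, hw, hwA⟩ := hall
  have hwC := Finset.mem_sdiff.1 hw
  have hpred {x : V} (hx : x ∈ C \ A) : x ≠ w → σ⁻¹ x ∈ A :=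
    inv_apply_mem_of_card_le_add_one hA hcard hw hwA hx
  have hsucc {x : V} (hx : x ∈ C \ A) : x ≠ σ⁻¹ w → σ x ∈ A :=
    inv_apply_mem_of_card_le_add_one (σ := σ⁻¹) hA' hcard
      (Finset.mem_sdiff.2 ⟨hC w hwC.1, hwA⟩) (by simpa using hwC.2) hx
  refine sum_degIn_le_two (u := σ⁻¹ w) (w := w) fun x hx y hy hxy ↦ ?_
  have hw_mem : x = w ∨ y = w := by
    by_contra! hne
    exact hnot (hpred hx hne.1) (hpred hy hne.2) hxy
  have hu_mem : x = σ⁻¹ w ∨ y = σ⁻¹ w := by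
    by_contra! hne
    exact hnot' (hsucc hx hne.1) (hsucc hy hne.2) hxy
  have hne := hfix w hwC.1
  grind [Sym2.eq_iff]

theorem mem_support_tail_iff {u x : V} {c : G.Walk u u} (hc : c.IsCycle) :
    x ∈ c.support.tail ↔ x ∈ c.support := by
  refine ⟨List.mem_of_mem_tail, fun hx ↦ ?_⟩
  rw [← c.cons_tail_support, List.mem_cons] at hx
  exact hx.elim (fun hxu ↦ hxu ▸ Walk.end_mem_tail_support hc.not_nil) id

variable [DecidableEq V] {a b u v w x y : V}

/-- The cyclic permutation sending each vertex of the closed walk `c` to the next one, for a cycle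
`c`, and fixing all other vertices. -/
def cycleSuccessor (c : G.Walk u u) : Equiv.Perm V := c.support.tail.formPerm

theorem cycleSuccessor_cons (hxy : G.Adj x y) (q : G.Walk y x) :
    cycleSuccessor (q.cons hxy) x = y := by
  have hlast := q.getLast_support
  rw [cycleSuccessor, Walk.support_cons, List.tail_cons]
  rw! [← q.cons_tail_support] at hlast ⊢
  exact (List.formPerm_eq_head_iff_eq_getLast _ x y).2 hlast.symm

theorem cycleSuccessor_append_cons {p : G.Walk u x} {hxy : G.Adj x y} {q : G.Walk y u}
    (hc : (p.append (q.cons hxy)).IsCycle) : cycleSuccessor (p.append (q.cons hxy)) x = y := by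
  have hrot : (p.append (q.cons hxy)).support.tail ~r ((q.append p).cons hxy).support.tail := by
    rw [Walk.tail_support_append, Walk.support_cons, Walk.support_cons, List.tail_cons,
      List.tail_cons, Walk.support_append]
    exact List.isRotated_append
  rw [cycleSuccessor, List.formPerm_eq_of_isRotated hc.support_nodup hrot]
  exact cycleSuccessor_cons hxy (q.append p)

theorem cycleSuccessor_reverse {c : G.Walk u u} (hc : c.IsCycle) :
    cycleSuccessor c.reverse = (cycleSuccessor c)⁻¹ := by
  have hrot : c.reverse.support.tail ~r c.support.tail.reverse := by
    rw [Walk.support_reverse, List.tail_reverse, List.isRotated_reverse_iff]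
    exact List.IsRotated.dropLast_tail (by simp) (by simp)
  rw [cycleSuccessor, List.formPerm_eq_of_isRotated hc.reverse.support_nodup hrot,
    List.formPerm_reverse, cycleSuccessor]

theorem card_toFinset_support {c : G.Walk u u} (hc : c.IsCycle) :
    c.support.toFinset.card = c.length := by
  have hC : c.support.toFinset = c.support.tail.toFinset := by
    ext x
    rw [List.mem_toFinset, List.mem_toFinset, mem_support_tail_iff hc]
  rw [hC, List.toFinset_card_of_nodup hc.support_nodup, List.length_tail, Walk.length_support,
    Nat.add_sub_cancel]

theorem cycleSuccessor_apply_mem {c : G.Walk u u} (hc : c.IsCycle) (hx : x ∈ c.support) :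
    cycleSuccessor c x ∈ c.support :=
  List.mem_of_mem_tail (List.formPerm_apply_mem_of_mem ((mem_support_tail_iff hc).2 hx))

theorem cycleSuccessor_apply_ne {c : G.Walk u u} (hc : c.IsCycle) (hx : x ∈ c.support) :
    cycleSuccessor c x ≠ x := by
  intro hfix
  have hle := (List.formPerm_apply_mem_eq_self_iff _ hc.support_nodup x
    ((mem_support_tail_iff hc).2 hx)).1 hfix
  rw [List.length_tail, Walk.length_support] at hle
  have := hc.three_le_length
  omega

namespace IsLongestCycle

variable {c : G.Walk u u}

theorem exists_rotation_cons (h : IsLongestCycle c) (hx : x ∈ c.support) :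
    ∃ (y : V) (hxy : G.Adj x y) (q : G.Walk y x), IsLongestCycle (q.cons hxy) ∧
      {z | z ∈ (q.cons hxy).support} = {z | z ∈ c.support} ∧
      cycleSuccessor (q.cons hxy) = cycleSuccessor c := by
  obtain ⟨d, hd, hdC, -, hrot⟩ := h.exists_rotation hx
  cases d with
  | nil => exact (hd.1.ne_nil rfl).elim
  | cons hxy q =>
    exact ⟨_, hxy, q, hd, hdC, List.formPerm_eq_of_isRotated hd.1.support_nodup hrot⟩

theorem not_adj_cycleSuccessor (h : IsLongestCycle c) (hv : v ∉ c.support) (ha : a ∈ c.support)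
    (hva : G.Adj v a) : ¬ G.Adj v (cycleSuccessor c a) := by
  obtain ⟨y, hay, q, hd, hdC, hσ⟩ := h.exists_rotation_cons ha
  rw [← hσ, cycleSuccessor_cons]
  exact hd.not_adj_of_adj (α := .nil) (fun hvd ↦ hv (hdC.subset hvd)) hva

theorem not_adj_cycleSuccessor_cycleSuccessor (h : IsLongestCycle c) (hv : v ∉ c.support)
    (ha : a ∈ c.support) (hb : b ∈ c.support) (hva : G.Adj v a) (hvb : G.Adj v b) :
    ¬ G.Adj (cycleSuccessor c a) (cycleSuccessor c b) := by
  rcases eq_or_ne a b with rfl | hab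
  · exact G.irrefl
  obtain ⟨a', haa', q, hd, hdC, hσ⟩ := h.exists_rotation_cons ha
  have hbq : b ∈ q.support := by
    have hbd : b ∈ (q.cons haa').support := hdC.superset hb
    rw [Walk.support_cons, List.mem_cons] at hbd
    exact hbd.resolve_left hab.symm
  obtain ⟨μ, β, rfl⟩ := Walk.mem_support_iff_exists_append.1 hbq
  cases β with
  | nil => exact (hab rfl).elim
  | cons hbb' β =>
    have hσb : cycleSuccessor ((μ.append (β.cons hbb')).cons haa') b = _ :=
      cycleSuccessor_append_cons (p := μ.cons haa') hd.1
    rw [← hσ, cycleSuccessor_cons, hσb]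
    exact hd.not_adj_of_adj_of_adj (fun hvd ↦ hv (hdC.subset hvd)) hab hva hvb

theorem cycleSuccessor_mem_sdiff (h : IsLongestCycle c) (hv : v ∉ c.support) {A : Finset V}
    (hA : ∀ a ∈ A, a ∈ c.support ∧ G.Adj v a) (ha : a ∈ A) :
    cycleSuccessor c a ∈ c.support.toFinset \ A :=
  Finset.mem_sdiff.2 ⟨List.mem_toFinset.2 (cycleSuccessor_apply_mem h.1 (hA a ha).1),
    fun hσ ↦ h.not_adj_cycleSuccessor hv (hA a ha).1 (hA a ha).2 (hA _ hσ).2⟩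

theorem sum_degIn_support_sdiff_le_two (h : IsLongestCycle c) (hv : v ∉ c.support) {A : Finset V}
    (hA : ∀ a ∈ A, a ∈ c.support ∧ G.Adj v a) (hlen : c.length ≤ 2 * A.card + 1) :
    ∑ x ∈ c.support.toFinset \ A, degIn G x (c.support.toFinset \ A) ≤ 2 := by
  have hmem (x : V) : x ∈ c.reverse.support ↔ x ∈ c.support := by
    rw [Walk.support_reverse, List.mem_reverse]
  have hA' (a : V) (ha : a ∈ A) : a ∈ c.reverse.support ∧ G.Adj v a :=
    (hA a ha).imp_left (hmem a).2
  have hC : c.reverse.support.toFinset = c.support.toFinset := Finset.ext fun x ↦ by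
    simp only [List.mem_toFinset, hmem]
  have hAC : A ⊆ c.support.toFinset := fun a ha ↦ List.mem_toFinset.2 (hA a ha).1
  have hv' := mt (hmem v).1 hv
  refine sum_degIn_sdiff_le_two (σ := cycleSuccessor c) ?_
    (fun a ha ↦ h.cycleSuccessor_mem_sdiff hv hA ha) ?_ ?_ ?_
    (fun a ha b hb ↦ h.not_adj_cycleSuccessor_cycleSuccessor hv (hA a ha).1 (hA b hb).1
      (hA a ha).2 (hA b hb).2) ?_
  · rw [Finset.card_sdiff_of_subset hAC, card_toFinset_support h.1]
    omega
  all_goals simp only [← cycleSuccessor_reverse h.1, ← hC]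
  · exact fun a ha ↦ h.reverse.cycleSuccessor_mem_sdiff hv' hA' ha
  · simpa only [List.mem_toFinset] using fun x hx ↦ cycleSuccessor_apply_mem h.1.reverse hx
  · simpa only [List.mem_toFinset] using fun x hx ↦ cycleSuccessor_apply_ne h.1.reverse hx
  · exact fun a ha b hb ↦ h.reverse.not_adj_cycleSuccessor_cycleSuccessor hv' (hA' a ha).1
      (hA' b hb).1 (hA a ha).2 (hA b hb).2

end IsLongestCycle

end CycleSuccessor

section CliqueCounting

open SimpleGraph

variable {V : Type*} {G : SimpleGraph V} {A D : Finset V} {s : ℕ}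

theorem sum_degIn_univ [Fintype V] : ∑ v, degIn G v Finset.univ = 2 * G.edgeSet.ncard := by
  classical
  rw [← coe_edgeFinset, Set.ncard_coe_finset, ← sum_degrees_eq_twice_card_edges]
  refine Finset.sum_congr rfl fun v _ ↦ ?_
  rw [degIn, ← card_neighborFinset_eq_degree, neighborFinset_eq_filter]

theorem degIn_induce (A : Finset V) (x : A) :
    degIn (G.induce (A : Set V)) x Finset.univ = degIn G x A := by
  classical
  simp only [degIn, Finset.card_filter]
  exact Finset.sum_coe_sort A fun y ↦ if G.Adj x y then 1 else 0

theorem sum_degIn_self (A : Finset V) :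
    ∑ x ∈ A, degIn G x A = 2 * (G.induce (A : Set V)).edgeSet.ncard := by
  rw [← sum_degIn_univ, ← Finset.sum_coe_sort A]
  exact Finset.sum_congr rfl fun x _ ↦ (degIn_induce A x).symm

theorem ncard_edgeSet_le_of_cliqueFree [Fintype V] (h : G.CliqueFree s) :
    G.edgeSet.ncard ≤ extremalNumber (Fintype.card V) (⊤ : SimpleGraph (Fin s)) := by
  classical
  have hfree : (⊤ : SimpleGraph (Fin s)).Free G := by
    rwa [← cliqueFree_iff_top_free, Fintype.card_fin]
  rw [← coe_edgeFinset, Set.ncard_coe_finset]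
  exact card_edgeFinset_le_extremalNumber hfree

theorem ncard_edgeSet_lt_of_cliqueFree [Fintype V] (h : G.CliqueFree s)
    (hs : s ≤ Fintype.card V) :
    G.edgeSet.ncard < extremalNumber (Fintype.card V) (⊤ : SimpleGraph (Fin (s + 1))) := by
  classical
  obtain ⟨x, y, hxy, hnadj⟩ : ∃ x y, x ≠ y ∧ ¬ G.Adj x y := by
    by_contra! hall
    obtain ⟨K, -, hK⟩ := Finset.exists_subset_card_eq (hs.trans_eq Finset.card_univ.symm)
    exact h K ⟨fun a _ b _ hab ↦ hall a b hab, hK⟩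
  have hle := ncard_edgeSet_le_of_cliqueFree (h.sup_edge x y)
  rw [← coe_edgeFinset, Set.ncard_coe_finset] at hle ⊢
  rwa [card_edgeFinset_sup_edge _ hnadj hxy] at hle

theorem sum_degIn_self_le (h : G.CliqueFreeOn A s) :
    ∑ x ∈ A, degIn G x A ≤ 2 * extremalNumber A.card (⊤ : SimpleGraph (Fin s)) := by
  have hle := ncard_edgeSet_le_of_cliqueFree ((cliqueFree_induce_iff G A s).2 h)
  rw [sum_degIn_self]
  simpa using hle

theorem sum_degIn_self_add_two_le (h : G.CliqueFreeOn A s) (hs : s ≤ A.card) :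
    ∑ x ∈ A, degIn G x A + 2 ≤ 2 * extremalNumber A.card (⊤ : SimpleGraph (Fin (s + 1))) := by
  have hlt := ncard_edgeSet_lt_of_cliqueFree ((cliqueFree_induce_iff G A s).2 h) (by simpa using hs)
  simp only [Finset.coe_sort_coe, Fintype.card_coe] at hlt
  rw [sum_degIn_self]
  omega

theorem sum_degIn_eq_add [DecidableEq V] (h : A ⊆ D) :
    ∑ v ∈ D, degIn G v D = ∑ v ∈ A, degIn G v A + 2 * ∑ v ∈ D \ A, degIn G v A +
      ∑ v ∈ D \ A, degIn G v (D \ A) := by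
  rw [← Finset.sum_sdiff h]
  simp only [← degIn_sdiff_add h, Finset.sum_add_distrib]
  have hcomm := sum_degIn_comm (G := G) (D \ A) A
  omega

theorem adj_of_degIn_eq_card {v a : V} (h : degIn G v A = A.card) (ha : a ∈ A) : G.Adj v a := by
  classical
  exact Finset.card_filter_eq_iff.1 h a ha

theorem sum_degIn_le_card_mul_card {B : Finset V} :
    ∑ x ∈ B, degIn G x A ≤ A.card * B.card := by
  rw [mul_comm]
  exact Finset.sum_le_card_nsmul B _ _ fun x _ ↦ degIn_le_card x A

theorem sum_degIn_self_add_le_of_adj {x y : V} {B : Finset V} (hs : s ≤ A.card)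
    (hG : G.CliqueFree (s + 2)) (hA : G.CliqueFreeOn A (s + 1)) (hx : x ∈ B) (hy : y ∈ B)
    (hxy : G.Adj x y) :
    ∑ z ∈ A, degIn G z A + 2 * ∑ z ∈ B, degIn G z A + 2 ≤
      2 * extremalNumber A.card (⊤ : SimpleGraph (Fin (s + 1))) + 2 * (A.card * B.card) := by
  -- Either `x` and `y` are complete to `A`, so `A` spans no `K_s`, or a cross edge is missing.
  by_cases hcomplete : ∀ z ∈ B, degIn G z A = A.card
  · have hAs : G.CliqueFreeOn A s := by
      have hNx := CliqueFreeOn.of_succ G (s := Set.univ) hG.cliqueFreeOn (Set.mem_univ x)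
      have hNxy := CliqueFreeOn.of_succ G hNx ⟨Set.mem_univ y, hxy⟩
      refine CliqueFreeOn.subset G (fun a ha ↦ ?_) hNxy
      exact ⟨⟨Set.mem_univ a, adj_of_degIn_eq_card (hcomplete x hx) ha⟩,
        adj_of_degIn_eq_card (hcomplete y hy) ha⟩
    have hsumA := sum_degIn_self_add_two_le hAs hs
    have hcross := sum_degIn_le_card_mul_card (G := G) (A := A) (B := B)
    omega
  · push Not at hcomplete
    obtain ⟨z, hz, hne⟩ := hcomplete
    have hsumA := sum_degIn_self_le hA
    have hcross : ∑ z ∈ B, degIn G z A < A.card * B.card := by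
      rw [mul_comm, ← smul_eq_mul, ← Finset.sum_const]
      exact Finset.sum_lt_sum (fun w _ ↦ degIn_le_card w A)
        ⟨z, hz, lt_of_le_of_ne (degIn_le_card z A) hne⟩
    omega

theorem sum_degIn_self_le_of_sum_sdiff_le_two [DecidableEq V] {v : V} (hs : s ≤ A.card)
    (hG : G.CliqueFree (s + 2)) (hAD : A ⊆ D) (hv : ∀ a ∈ A, G.Adj v a)
    (hB : ∑ x ∈ D \ A, degIn G x (D \ A) ≤ 2) :
    ∑ x ∈ D, degIn G x D ≤
      2 * extremalNumber A.card (⊤ : SimpleGraph (Fin (s + 1))) +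
        2 * (A.card * (D.card - A.card)) := by
  have hN := CliqueFreeOn.of_succ G (s := Set.univ) hG.cliqueFreeOn (Set.mem_univ v)
  have hA : G.CliqueFreeOn A (s + 1) :=
    CliqueFreeOn.subset G (s₂ := Set.univ ∩ G.neighborSet v)
      (fun a ha ↦ ⟨Set.mem_univ a, hv a ha⟩) hN
  rw [sum_degIn_eq_add hAD, ← Finset.card_sdiff_of_subset hAD]
  by_cases hedge : ∃ x ∈ D \ A, ∃ y ∈ D \ A, G.Adj x y
  · obtain ⟨x, hx, y, hy, hxy⟩ := hedge
    have := sum_degIn_self_add_le_of_adj hs hG hA hx hy hxy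
    omega
  · push Not at hedge
    have hzero : ∑ x ∈ D \ A, degIn G x (D \ A) = 0 :=
      Finset.sum_eq_zero fun x hx ↦ degIn_eq_zero.2 (hedge x hx)
    have hsumA := sum_degIn_self_le hA
    have hcross := sum_degIn_le_card_mul_card (G := G) (A := A) (B := D \ A)
    omega

end CliqueCounting

section UpperBound

theorem add_mul_sub_le_of_sq_le {c k n t : ℕ} (htk : 2 * t + 1 ≤ k) (hck : c < k)
    (hct : c ≤ 2 * t + 1) (hcn : c ≤ n) (hkn : k ^ 2 ≤ 2 * n) :
    c * (c - 1) + (2 * t - 1) * (n - c) ≤ 2 * (t * (n - t)) := by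
  -- `c² + 2t² - 2tc = t² + (c - t)²`, which is at most `k² / 2` in both cases
  have hcc : c * c + 2 * t * t ≤ 2 * t * c + n := by
    rcases hct.eq_or_lt with rfl | _ <;> nlinarith
  rcases t.eq_zero_or_pos with rfl | ht
  · interval_cases c <;> simp
  have htn : t ≤ n := by nlinarith
  have hc : c ≤ c * c := Nat.le_mul_self c
  rw [Nat.mul_sub_one]
  zify [hc, hcn, htn, (by omega : 1 ≤ 2 * t)] at hcc ⊢
  linarith

open SimpleGraph

variable {V : Type*} [Fintype V] {G : SimpleGraph V} {u v : V} {c : G.Walk u u}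
  {t : ℕ}

section Counting

variable [DecidableEq V]

theorem sum_degIn_univ_of_isolated {C U : Finset V} (hU : U ⊆ Cᶜ)
    (hiso : ∀ v ∈ U, ∀ w ∈ Cᶜ, ¬ G.Adj v w) :
    ∑ v, degIn G v Finset.univ = ∑ v ∈ C, degIn G v C +
      ∑ v ∈ Cᶜ \ U, (degIn G v (Cᶜ \ U) + 2 * degIn G v C) + 2 * ∑ v ∈ U, degIn G v C := by
  have hUW : ∑ v ∈ U, degIn G v (Cᶜ \ U) = 0 := Finset.sum_eq_zero fun v hv ↦
    degIn_eq_zero.2 fun w hw ↦ hiso v hv w (Finset.sdiff_subset hw)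
  have hUU : ∑ v ∈ U, degIn G v U = 0 := Finset.sum_eq_zero fun v hv ↦
    degIn_eq_zero.2 fun w hw ↦ hiso v hv w (hU hw)
  have hWU := (sum_degIn_comm (G := G) (Cᶜ \ U) U).trans hUW
  rw [sum_degIn_eq_add (Finset.subset_univ C), ← Finset.compl_eq_univ_sdiff, sum_degIn_eq_add hU,
    ← Finset.sum_sdiff (f := fun v ↦ degIn G v C) hU, Finset.sum_add_distrib, ← Finset.mul_sum]
  omega

theorem IsLongestCycle.exists_two_mul_ncard_edgeSet_le (h : IsLongestCycle c)
    (h2 : IsTwoConnected G) (ht : 2 ≤ t) (hct : c.length ≤ 2 * t + 1) :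
    ∃ U ⊆ c.support.toFinsetᶜ, 2 * G.edgeSet.ncard ≤
      ∑ v ∈ c.support.toFinset, degIn G v c.support.toFinset +
        (2 * t - 1) * (c.support.toFinsetᶜ \ U).card +
        2 * ∑ v ∈ U, degIn G v c.support.toFinset := by
  classical
  let U : Finset V := {v ∈ c.support.toFinsetᶜ | ∀ w ∈ c.support.toFinsetᶜ, ¬ G.Adj v w}
  have hU : U ⊆ c.support.toFinsetᶜ := Finset.filter_subset _ _
  have hmem (v : V) : v ∈ c.support.toFinsetᶜ ↔ v ∉ c.support := by
    rw [Finset.mem_compl, List.mem_toFinset]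
  refine ⟨U, hU, ?_⟩
  have hW := sum_degIn_add_two_mul_degIn_le h2 ht h hct (D := c.support.toFinsetᶜ \ U)
    (fun v hv ↦ (hmem v).1 (Finset.sdiff_subset hv)) fun v hv ↦ by
      obtain ⟨hvC, hvU⟩ := Finset.mem_sdiff.1 hv
      simpa [U, hvC, (hmem v).1 hvC] using hvU
  rw [← sum_degIn_univ, sum_degIn_univ_of_isolated hU fun v hv ↦ (Finset.mem_filter.1 hv).2]
  omega

theorem IsLongestCycle.ncard_edgeSet_le_of_degIn_eq {s : ℕ} (h : IsLongestCycle c)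
    (hv : v ∉ c.support) (hvt : degIn G v c.support.toFinset = t) (hct : c.length ≤ 2 * t + 1)
    (hst : s ≤ t) (hG : G.CliqueFree (s + 2)) {U : Finset V} (hU : U ⊆ c.support.toFinsetᶜ)
    (hle : 2 * G.edgeSet.ncard ≤
      ∑ v ∈ c.support.toFinset, degIn G v c.support.toFinset +
        (2 * t - 1) * (c.support.toFinsetᶜ \ U).card +
        2 * ∑ v ∈ U, degIn G v c.support.toFinset) :
    G.edgeSet.ncard ≤
      extremalNumber t (⊤ : SimpleGraph (Fin (s + 1))) + t * (Fintype.card V - t) := by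
  classical
  set C := c.support.toFinset
  obtain ⟨A, hA, hAt⟩ : ∃ A : Finset V, (∀ a, a ∈ A ↔ a ∈ C ∧ G.Adj v a) ∧ A.card = t :=
    ⟨C.filter (G.Adj v), by simp, hvt⟩
  have hAC : A ⊆ C := fun a ha ↦ ((hA a).1 ha).1
  have hinner : ∑ x ∈ C, degIn G x C ≤
      2 * extremalNumber t (⊤ : SimpleGraph (Fin (s + 1))) + 2 * (t * (C.card - t)) := by
    have hB := h.sum_degIn_support_sdiff_le_two hv (A := A)
      (fun a ha ↦ by simpa [C] using (hA a).1 ha) (hAt ▸ hct)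
    exact hAt ▸ sum_degIn_self_le_of_sum_sdiff_le_two (hAt ▸ hst) hG hAC
      (fun a ha ↦ ((hA a).1 ha).2) hB
  have hUsum : ∑ x ∈ U, degIn G x C ≤ U.card * t :=
    Finset.sum_le_card_nsmul U _ t fun x hx ↦ by
      have hxc : x ∉ c.support := by simpa [C] using hU hx
      have hx : 2 * degIn G x C ≤ c.length := h.two_mul_degIn_le hxc
      omega
  have hWle : (2 * t - 1) * (Cᶜ \ U).card ≤ 2 * t * (Cᶜ \ U).card :=
    Nat.mul_le_mul_right _ (by omega)
  have hcard : Fintype.card V - t = (C.card - t) + (Cᶜ \ U).card + U.card := by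
    have htC : t ≤ C.card := hAt ▸ Finset.card_le_card hAC
    have hCV := Finset.card_add_card_compl C
    have hUC := Finset.card_sdiff_add_card_eq_card hU
    omega
  rw [hcard]
  nlinarith

theorem IsLongestCycle.ncard_edgeSet_le_of_degIn_lt {k : ℕ} (h : IsLongestCycle c)
    (htk : 2 * t + 1 ≤ k) (hck : c.length < k) (hct : c.length ≤ 2 * t + 1)
    (hkn : k ^ 2 ≤ 2 * Fintype.card V)
    {U : Finset V} (hU : U ⊆ c.support.toFinsetᶜ)
    (hlt : ∀ v ∈ U, degIn G v c.support.toFinset < t)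
    (hle : 2 * G.edgeSet.ncard ≤
      ∑ v ∈ c.support.toFinset, degIn G v c.support.toFinset +
        (2 * t - 1) * (c.support.toFinsetᶜ \ U).card +
        2 * ∑ v ∈ U, degIn G v c.support.toFinset) :
    G.edgeSet.ncard ≤ t * (Fintype.card V - t) := by
  have hC := card_toFinset_support h.1
  set C := c.support.toFinset
  have hinner : ∑ v ∈ C, degIn G v C ≤ C.card * (C.card - 1) :=
    Finset.sum_le_card_nsmul C _ _ fun v hv ↦ Nat.le_sub_one_of_lt (degIn_lt_card hv)
  have hUsum : ∑ v ∈ U, degIn G v C ≤ U.card * (t - 1) :=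
    Finset.sum_le_card_nsmul U _ _ fun v hv ↦ Nat.le_sub_one_of_lt (hlt v hv)
  have hUle : 2 * (U.card * (t - 1)) ≤ (2 * t - 1) * U.card := by
    rw [mul_comm U.card, ← mul_assoc]
    exact Nat.mul_le_mul_right _ (by omega)
  have hcard : (2 * t - 1) * (Fintype.card V - C.card) =
      (2 * t - 1) * (Cᶜ \ U).card + (2 * t - 1) * U.card := by
    rw [← Finset.card_compl, ← Finset.card_sdiff_add_card_eq_card hU, mul_add]
  have hquad := add_mul_sub_le_of_sq_le htk (hC ▸ hck) (hC ▸ hct) (Finset.card_le_univ C) hkn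
  omega

end Counting

theorem IsTwoConnected.ncard_edgeSet_le {k s : ℕ} (h2 : IsTwoConnected G) (hk : 5 ≤ k)
    (hs : s ≤ (k - 1) / 2) (hkn : k ^ 2 ≤ 2 * Fintype.card V) (hG : G.CliqueFree (s + 2))
    (hcyc : ∀ x (d : G.Walk x x), d.IsCycle → d.length < k) :
    G.edgeSet.ncard ≤ extremalNumber ((k - 1) / 2) (⊤ : SimpleGraph (Fin (s + 1))) +
      (k - 1) / 2 * (Fintype.card V - (k - 1) / 2) := by
  classical
  obtain ⟨x, c, h⟩ := h2.exists_isLongestCycle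
  have hck := hcyc x c h.1
  have hct : c.length ≤ 2 * ((k - 1) / 2) + 1 := by omega
  obtain ⟨U, hU, hle⟩ := h.exists_two_mul_ncard_edgeSet_le h2 (by omega) hct
  by_cases hex : ∃ v ∈ U, degIn G v c.support.toFinset = (k - 1) / 2
  · obtain ⟨v, hvU, hvt⟩ := hex
    have hv : v ∉ c.support := by simpa using hU hvU
    exact h.ncard_edgeSet_le_of_degIn_eq hv hvt hct hs hG hU hle
  · push Not at hex
    have hlt (v : V) (hvU : v ∈ U) : degIn G v c.support.toFinset < (k - 1) / 2 := by
      have := h.two_mul_degIn_le (v := v) (by simpa using hU hvU)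
      have := hex v hvU
      omega
    exact le_add_left (h.ncard_edgeSet_le_of_degIn_lt (by omega) hck hct hkn hU hlt hle)

end UpperBound

section JoinGraph

variable {V W : Type*} {G : SimpleGraph V} {H : SimpleGraph W}

@[simp]
theorem graphJoin_adj_inl_inl {v w : V} :
    (graphJoin G H).Adj (Sum.inl v) (Sum.inl w) ↔ G.Adj v w := by
  simp [graphJoin]

@[simp]
theorem graphJoin_adj_inl_inr {v : V} {w : W} :
    (graphJoin G H).Adj (Sum.inl v) (Sum.inr w) := by
  simp [graphJoin]

@[simp]
theorem graphJoin_adj_inr_inl {v : V} {w : W} :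
    (graphJoin G H).Adj (Sum.inr w) (Sum.inl v) := by
  simp [graphJoin]

@[simp]
theorem graphJoin_adj_inr_inr {v w : W} :
    (graphJoin G H).Adj (Sum.inr v) (Sum.inr w) ↔ H.Adj v w := by
  simp [graphJoin]

theorem connected_of_forall_adj {P : V → Prop} (h : ∀ v w, P v → ¬ P w → G.Adj v w)
    {v w : V} (hv : P v) (hw : ¬ P w) : G.Connected := by
  have hreach (x : V) : G.Reachable x v := by
    by_cases hx : P x
    · exact (h x w hx hw).reachable.trans (h v w hv hw).reachable.symm
    · exact (h v x hv hx).reachable.symm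
  have : Nonempty V := ⟨v⟩
  exact ⟨fun x y ↦ (hreach x).trans (hreach y).symm⟩

theorem isTwoConnected_of_forall_adj [Finite V] {P : V → Prop}
    (h : ∀ v w, P v → ¬ P w → G.Adj v w) {v v' w w' : V} (hv : P v) (hv' : P v') (hvv : v ≠ v')
    (hw : ¬ P w) (hw' : ¬ P w') (hww : w ≠ w') : IsTwoConnected G := by
  refine ⟨?_, connected_of_forall_adj h hv hw, fun x ↦ ?_⟩
  · have hne (y : V) (hy : P y) : y ≠ w := fun hyw ↦ hw (hyw ▸ hy)
    rw [← Set.ncard_univ, ← Set.ncard_eq_three.2 ⟨v, v', w, hvv, hne v hv, hne v' hv', rfl⟩]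
    exact Set.ncard_le_ncard (Set.subset_univ _)
  · obtain ⟨y, hy, hyx⟩ : ∃ y, P y ∧ y ≠ x := by
      by_cases hvx : v = x
      · exact ⟨v', hv', hvx ▸ hvv.symm⟩
      · exact ⟨v, hv, hvx⟩
    obtain ⟨z, hz, hzx⟩ : ∃ z, ¬ P z ∧ z ≠ x := by
      by_cases hwx : w = x
      · exact ⟨w', hw', hwx ▸ hww.symm⟩
      · exact ⟨w, hw, hwx⟩
    exact connected_of_forall_adj (P := fun p : ({x}ᶜ : Set V) ↦ P p)
      (fun p q ↦ h p q) (v := ⟨y, hyx⟩) (w := ⟨z, hzx⟩) hy hz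

theorem isTwoConnected_graphJoin [Finite V] [Finite W] [Nontrivial V] [Nontrivial W] :
    IsTwoConnected (graphJoin G H) := by
  obtain ⟨v, v', hv⟩ := exists_pair_ne V
  obtain ⟨w, w', hw⟩ := exists_pair_ne W
  refine isTwoConnected_of_forall_adj (P := fun x ↦ x.isLeft) ?_ (v := .inl v) (v' := .inl v')
    (w := .inr w) (w' := .inr w') rfl rfl (Sum.inl_injective.ne hv) (by simp) (by simp)
    (Sum.inr_injective.ne hw)
  rintro (x | x) (y | y) hx hy <;> simp at hx hy ⊢

theorem IsTwoConnected.of_iso (e : G ≃g H) (h : IsTwoConnected G) : IsTwoConnected H := by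
  refine ⟨Nat.card_congr e.toEquiv ▸ h.1, e.connected_iff.1 h.2.1, fun w ↦ ?_⟩
  let e' : G.induce {e.symm w}ᶜ ≃g H.induce {w}ᶜ :=
    ⟨e.toEquiv.subtypeEquiv fun v ↦ by simp [← e.apply_eq_iff_eq], e.map_adj_iff⟩
  exact e'.connected_iff.1 (h.2.2 _)

theorem cliqueFree_graphJoin_bot {s : ℕ} (h : G.CliqueFree s) :
    (graphJoin G (⊥ : SimpleGraph W)).CliqueFree (s + 1) := by
  intro K hK
  have hL : G.IsNClique K.toLeft.card K.toLeft := by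
    refine ⟨fun v hv w hw hvw ↦ ?_, rfl⟩
    have hadj := hK.1 (Finset.mem_toLeft.1 hv) (Finset.mem_toLeft.1 hw) (by simpa using hvw)
    exact graphJoin_adj_inl_inl.1 hadj
  have hR : K.toRight.card ≤ 1 := by
    refine Finset.card_le_one.2 fun v hv w hw ↦ ?_
    by_contra hvw
    have hadj := hK.1 (Finset.mem_toRight.1 hv) (Finset.mem_toRight.1 hw) (by simpa using hvw)
    exact graphJoin_adj_inr_inr.1 hadj
  have hsum : K.toLeft.card + K.toRight.card = s + 1 :=
    Finset.card_toLeft_add_card_toRight.trans hK.2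
  exact h.mono (by omega) _ hL

theorem cycleGraph_free_graphJoin_bot [Fintype V] {m : ℕ} (hm : 3 ≤ m)
    (hV : 2 * Fintype.card V < m) :
    (SimpleGraph.cycleGraph m).Free (graphJoin G (⊥ : SimpleGraph W)) := by
  rintro ⟨f⟩
  obtain ⟨m, rfl⟩ := Nat.exists_eq_add_of_le' (show 2 ≤ m by omega)
  let L : Finset (Fin (m + 2)) := {i | (f i).isLeft}
  let R : Finset (Fin (m + 2)) := {i | ¬ (f i).isLeft}
  -- the successor on the cycle of a vertex of the independent set lies in the other part
  have hRL : R.card ≤ L.card := by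
    refine Finset.card_le_card_of_injOn (· + 1) (fun i hi ↦ ?_) (add_left_injective 1).injOn
    have hadj : (graphJoin G (⊥ : SimpleGraph W)).Adj (f i) (f (i + 1)) :=
      f.toHom.map_adj (SimpleGraph.cycleGraph_adj.2 (Or.inr (by simp)))
    rcases hfi : f i with v | v <;> rcases hfj : f (i + 1) with w | w <;> simp_all [L, R]
  have hLV : L.card ≤ Fintype.card V := by
    rw [← Finset.card_univ, ← Finset.card_map (s := Finset.univ) (Function.Embedding.inl (β := W))]
    refine Finset.card_le_card_of_injOn f (fun i hi ↦ ?_) f.injective.injOn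
    obtain ⟨v, hv⟩ := Sum.isLeft_iff.1 (Finset.mem_filter.1 hi).2
    simp [hv]
  have hLR : L.card + R.card = m + 2 := by
    rw [Finset.card_filter_add_card_filter_not, Finset.card_univ, Fintype.card_fin]
  omega

theorem ncard_edgeSet_graphJoin_bot [Fintype V] [Fintype W] [DecidableRel G.Adj] :
    (graphJoin G (⊥ : SimpleGraph W)).edgeSet.ncard =
      G.edgeFinset.card + Fintype.card V * Fintype.card W := by
  classical
  have hl (v : V) : degIn (graphJoin G (⊥ : SimpleGraph W)) (Sum.inl v) Finset.univ =
      G.degree v + Fintype.card W := by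
    rw [← SimpleGraph.card_neighborFinset_eq_degree, SimpleGraph.neighborFinset_eq_filter, degIn]
    simp only [Finset.card_filter, Fintype.sum_sum_type, graphJoin_adj_inl_inl,
      graphJoin_adj_inl_inr, if_true, Finset.sum_const, Finset.card_univ, smul_eq_mul, mul_one]
  have hr (w : W) : degIn (graphJoin G (⊥ : SimpleGraph W)) (Sum.inr w) Finset.univ =
      Fintype.card V := by
    simp only [degIn, Finset.card_filter, Fintype.sum_sum_type, graphJoin_adj_inr_inl,
      graphJoin_adj_inr_inr, SimpleGraph.bot_adj, if_true, if_false, Finset.sum_const_zero,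
      add_zero, Finset.sum_const, Finset.card_univ, smul_eq_mul, mul_one]
  have hsum := sum_degIn_univ (G := graphJoin G (⊥ : SimpleGraph W))
  simp only [Fintype.sum_sum_type, hl, hr, Finset.sum_add_distrib,
    SimpleGraph.sum_degrees_eq_twice_card_edges, Finset.sum_const, Finset.card_univ,
    smul_eq_mul, mul_comm (Fintype.card W)] at hsum
  omega

theorem ncard_edgeSet_eq_of_iso (e : G ≃g H) : G.edgeSet.ncard = H.edgeSet.ncard :=
  Nat.card_congr e.mapEdgeSet

end JoinGraph

theorem ncard_edgeSet_graphG2 (n k r : ℕ) (hr : 3 ≤ r) : (graphG2 n k r).edgeSet.ncard =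
    SimpleGraph.extremalNumber ((k - 1) / 2) (⊤ : SimpleGraph (Fin (r - 1))) +
      (k - 1) / 2 * (n - (k - 1) / 2) := by
  have : Nontrivial (Fin (r - 1)) := Fin.nontrivial_iff_two_le.2 (by omega)
  have hcard : r - 2 = Fintype.card (Fin (r - 1)) - 1 := by rw [Fintype.card_fin]; omega
  rw [graphG2, hcard, ncard_edgeSet_graphJoin_bot, SimpleGraph.extremalNumber_top]
  simp only [Fintype.card_fin]

theorem familyFree_graphG2 (n : ℕ) {k r : ℕ} (hr : 3 ≤ r) (hk : 5 ≤ k) :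
    FamilyFree (cliqueAndLongCycles r k) (graphG2 n k r) := by
  rintro _ (rfl | ⟨m, hkm, rfl⟩)
  · obtain ⟨s, rfl⟩ := Nat.exists_eq_add_of_le' hr
    have hclique := cliqueFree_graphJoin_bot (W := Fin (n - (k - 1) / 2))
      (SimpleGraph.turanGraph_cliqueFree (n := (k - 1) / 2) (r := s + 1) s.succ_pos)
    rw [← SimpleGraph.cliqueFree_iff_top_free, Fintype.card_fin]
    exact hclique
  · exact cycleGraph_free_graphJoin_bot (by omega) (by rw [Fintype.card_fin]; omega)

theorem ncard_edgeSet_mem_twoConnEdgeCounts {V : Type*} [Finite V] {G : SimpleGraph V}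
    {F : GraphFamily} (h2 : IsTwoConnected G) (hF : FamilyFree F G) :
    G.edgeSet.ncard ∈ twoConnEdgeCounts (Nat.card V) F := by
  have e := SimpleGraph.Iso.map (Finite.equivFin V) G
  exact ⟨_, h2.of_iso e, fun H hH ↦ (SimpleGraph.free_congr_right e).1 (hF H hH),
    (ncard_edgeSet_eq_of_iso e).symm⟩

theorem graphG2_mem_twoConnEdgeCounts {n k r : ℕ} (hr : 3 ≤ r) (hk : 5 ≤ k) (hkn : k ≤ n) :
    (graphG2 n k r).edgeSet.ncard ∈ twoConnEdgeCounts n (cliqueAndLongCycles r k) := by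
  have : Nontrivial (Fin ((k - 1) / 2)) := Fin.nontrivial_iff_two_le.2 (by omega)
  have : Nontrivial (Fin (n - (k - 1) / 2)) := Fin.nontrivial_iff_two_le.2 (by omega)
  have hcard : Nat.card (Fin ((k - 1) / 2) ⊕ Fin (n - (k - 1) / 2)) = n := by
    rw [Nat.card_sum, Nat.card_fin, Nat.card_fin]; omega
  have h := ncard_edgeSet_mem_twoConnEdgeCounts isTwoConnected_graphJoin
    (familyFree_graphG2 n hr hk)
  rwa [hcard] at h

theorem theorem5_general (n k r : ℕ) (hr : 3 ≤ r) (hrk : r ≤ (k - 1) / 2 + 2) (hk : 5 ≤ k)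
    (hn : (k : ℝ) ^ 2 / 2 ≤ (n : ℝ)) :
    IsGreatest (twoConnEdgeCounts n (cliqueAndLongCycles r k)) (graphG2 n k r).edgeSet.ncard ∧
    (graphG2 n k r).edgeSet.ncard =
      SimpleGraph.extremalNumber ((k - 1) / 2) (⊤ : SimpleGraph (Fin (r - 1))) +
        (k - 1) / 2 * (n - (k - 1) / 2) := by
  have hn' : k ^ 2 ≤ 2 * n := by
    rw [div_le_iff₀ two_pos, mul_comm] at hn
    exact_mod_cast hn
  have hkn : k ≤ n := by nlinarith
  refine ⟨⟨graphG2_mem_twoConnEdgeCounts hr hk hkn, ?_⟩, ncard_edgeSet_graphG2 n k r hr⟩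
  rintro _ ⟨G, h2, hfree, rfl⟩
  have hcyc (x : Fin n) (d : G.Walk x x) (hd : d.IsCycle) : d.length < k := by
    by_contra! hkd
    exact hfree _ (Set.mem_insert_of_mem _ ⟨d.length, hkd, rfl⟩)
      ((SimpleGraph.cycleGraph_isContained_iff hd.three_le_length).2 ⟨x, d, hd, rfl⟩)
  obtain ⟨s, rfl⟩ := Nat.exists_eq_add_of_le' (show 2 ≤ r by omega)
  have hclique : G.CliqueFree (s + 2) := by
    have h := hfree ⟨s + 2, ⊤⟩ (Set.mem_insert _ _)
    rwa [← SimpleGraph.cliqueFree_iff_top_free, Fintype.card_fin] at h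
  rw [ncard_edgeSet_graphG2 n k _ hr]
  simpa using h2.ncard_edgeSet_le hk (by omega) (by simpa using hn') hclique hcyc

theorem theorem5 (n k r : ℕ) (hr : 3 ≤ r) (hrk : r ≤ (k - 1) / 2 + 1) (hk : 5 ≤ k) (hkn : k ≤ n)
    (hn : (k : ℝ) ^ 2 / 2 ≤ (n : ℝ)) :
    IsGreatest (twoConnEdgeCounts n (cliqueAndLongCycles r k)) (graphG2 n k r).edgeSet.ncard ∧
    (graphG2 n k r).edgeSet.ncard =
      SimpleGraph.extremalNumber ((k - 1) / 2) (⊤ : SimpleGraph (Fin (r - 1))) +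
        (k - 1) / 2 * (n - (k - 1) / 2) :=
  theorem5_general n k r hr (by omega) hk hn
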